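/- Let $n$ be an integer with $|n|\ge 1$, let $\alpha>0$ and $R>0$, and let $r_0$ $(\approx 2.404825)$ be the first positive zero of the Bessel function $J_0$. Let $\kappa$ be a real number with $$-\frac{n^2+r_0^2}{2R^2}<\kappa<\alpha^{-1}-\frac{n^2+r_0^2}{2R^2} \qquad\text{and}\qquad R>\left(\frac{6\,(1+n^2(2\ln 2-1))}{\alpha^{-1}-\kappa}\right)^{1/2}.$$ Then there is a function $u:[0,R]\to\mathbb{R}$, continuous on $[0,R]$ and twice continuously differentiable on $(0,R)$, with $u(r)>0$ for all $r\in(0,R)$, which solves the $n$-vortex equation $$(ru_r)_r-\frac{n^2}{r}u+\frac{2ru^3}{1+\alpha u^2}-2\kappa ru=0\quad\text{on }(0,R),\qquad u(0)=u(R)=0.$$ Moreover, $u$ can be chosen to be a minimiser on the Nehari manifold, in the following sense. Let $H$ be the completion of $\{u\in C^1[0,R]: u(0)=u(R)=0\}$ with respect to the inner product $(u,v)=\int_0^R\{ru_rv_r+\frac1r uv\}\,dr$; its elements are regarded as functions on $(0,R)$ with a weak derivative. For $u\in H$ let $$\mathcal I_\kappa(u)=\frac12\int_0^R\Big\{ru_r^2+\frac{n^2}{r}u^2-2(\alpha^{-1}-\kappa)ru^2+2\alpha^{-2}r\ln(1+\alpha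 u^2)\Big\}dr,$$ $$\gamma_\kappa(u)=\frac12\int_0^R\Big\{ru_r^2+\frac{n^2}{r}u^2-2(\alpha^{-1}-\kappa)ru^2+2\alpha^{-1}\frac{ru^2}{1+\alpha u^2}\Big\}dr,$$ and let $\mathcal M=\{u\in H\setminus\{0\}:\gamma_\kappa(u)=0\}$. Then $u\in\mathcal M$ and $\mathcal I_\kappa(u)=\min_{v\in\mathcal M}\mathcal I_\kappa(v)$. -/

import Mathlib

open MeasureTheory Set

noncomputable section

namespace Vortex

/-- The Bessel function of the first kind of order zero,
`J₀(x) = ∑ (-1)^m / (m!)² (x/2)^(2m)`. -/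
def besselJ0 (x : ℝ) : ℝ :=
  ∑' m : ℕ, (-1 : ℝ) ^ m / ((m.factorial : ℝ) ^ 2) * (x / 2) ^ (2 * m)

/-- The measure `r dr` on the interval `(0, R)`. -/
def radialMeasure (R : ℝ) : Measure ℝ :=
  (volume.restrict (Ioo 0 R)).withDensity fun r => ENNReal.ofReal r

/-- The measure `r⁻¹ dr` on the interval `(0, R)`. -/
def invRadialMeasure (R : ℝ) : Measure ℝ :=
  (volume.restrict (Ioo 0 R)).withDensity fun r => ENNReal.ofReal r⁻¹

/-- The space `X` of functions that are `C¹` on `[0, R]` and vanish at both endpoints. Functions are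
total on `ℝ`; their values outside `[0, R]` play no role below. -/
def testSpace (R : ℝ) : Submodule ℝ (ℝ → ℝ) where
  carrier := {φ | ContDiffOn ℝ 1 φ (Icc 0 R) ∧ φ 0 = 0 ∧ φ R = 0}
  add_mem' := by
    rintro φ ψ ⟨h1, h2, h3⟩ ⟨k1, k2, k3⟩
    exact ⟨h1.add k1, by simp [h2, k2], by simp [h3, k3]⟩
  zero_mem' := ⟨contDiffOn_const, rfl, rfl⟩
  smul_mem' := by
    rintro c φ ⟨h1, h2, h3⟩
    exact ⟨contDiffOn_const.smul h1, by simp [h2], by simp [h3]⟩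

theorem testSpace_hasDerivAt {R : ℝ} (φ : testSpace R) {r : ℝ} (hr : r ∈ Ioo 0 R) :
    HasDerivAt (φ : ℝ → ℝ) (deriv (φ : ℝ → ℝ) r) r :=
  (((φ.2.1.differentiableOn (by norm_num)) r (Ioo_subset_Icc_self hr)).differentiableAt
    (Icc_mem_nhds hr.1 hr.2)).hasDerivAt

theorem testSpace_deriv_bound {R : ℝ} (φ : testSpace R) :
    ∃ C : ℝ, ∀ r ∈ Ioo 0 R, |deriv (φ : ℝ → ℝ) r| ≤ C := by
  rcases le_or_gt R 0 with hR | hR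
  · exact ⟨0, fun r hr => absurd (hr.1.trans hr.2) (not_lt.2 hR)⟩
  · obtain ⟨C, hC⟩ := isCompact_Icc.exists_bound_of_continuousOn
      (φ.2.1.continuousOn_derivWithin (uniqueDiffOn_Icc hR) le_rfl)
    refine ⟨C, fun r hr => ?_⟩
    have := hC r (Ioo_subset_Icc_self hr)
    rwa [derivWithin_of_mem_nhds (Icc_mem_nhds hr.1 hr.2), Real.norm_eq_abs] at this

theorem testSpace_bound {R : ℝ} (φ : testSpace R) :
    ∃ C : ℝ, ∀ r ∈ Ioo 0 R, |deriv (φ : ℝ → ℝ) r| ≤ C ∧ |(φ : ℝ → ℝ) r| ≤ C * r := by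
  obtain ⟨C, hC⟩ := testSpace_deriv_bound φ
  refine ⟨C, fun r hr => ⟨hC r hr, ?_⟩⟩
  obtain ⟨c, hc, hc'⟩ := exists_deriv_eq_slope (φ : ℝ → ℝ) hr.1
    (φ.2.1.continuousOn.mono (Icc_subset_Icc_right hr.2.le))
    (fun s hs => (testSpace_hasDerivAt φ
      ⟨hs.1, hs.2.trans hr.2⟩).differentiableAt.differentiableWithinAt)
  have h := hC c ⟨hc.1, hc.2.trans hr.2⟩
  rw [hc', φ.2.2.1, sub_zero, sub_zero, abs_div, abs_of_pos hr.1, div_le_iff₀ hr.1] at h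
  exact h

theorem testSpace_memLp_deriv {R : ℝ} (φ : testSpace R) :
    MemLp (deriv (φ : ℝ → ℝ)) 2 (radialMeasure R) := by
  obtain ⟨C, hC⟩ := testSpace_bound φ
  rw [memLp_two_iff_integrable_sq (measurable_deriv _).aestronglyMeasurable, radialMeasure,
    integrable_withDensity_iff (by fun_prop) (by simp)]
  refine Measure.integrableOn_of_bounded (M := C ^ 2 * R) (by simp)
    (((measurable_deriv _).pow_const 2).mul (by fun_prop)).aestronglyMeasurable ?_
  filter_upwards [ae_restrict_mem measurableSet_Ioo] with r hr
  rw [ENNReal.toReal_ofReal hr.1.le, Real.norm_eq_abs, abs_of_nonneg (by have := hr.1; positivity)]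
  have h1 : (deriv (φ : ℝ → ℝ) r) ^ 2 ≤ C ^ 2 := by
    rw [← sq_abs]; gcongr; exact (hC r hr).1
  exact mul_le_mul h1 hr.2.le hr.1.le (sq_nonneg C)

theorem testSpace_memLp {R : ℝ} (φ : testSpace R) :
    MemLp (φ : ℝ → ℝ) 2 (invRadialMeasure R) := by
  obtain ⟨C, hC⟩ := testSpace_bound φ
  have hm : AEStronglyMeasurable (φ : ℝ → ℝ) (volume.restrict (Ioo 0 R)) :=
    (φ.2.1.continuousOn.mono Ioo_subset_Icc_self).aestronglyMeasurable measurableSet_Ioo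
  rw [invRadialMeasure,
    memLp_two_iff_integrable_sq (hm.mono_ac (withDensity_absolutelyContinuous _ _)),
    integrable_withDensity_iff (by fun_prop) (by simp)]
  refine Integrable.of_bound ((hm.pow 2).mul
    (Measurable.aestronglyMeasurable (f := fun r : ℝ => (ENNReal.ofReal r⁻¹).toReal)
      (by fun_prop))) (C ^ 2 * R) ?_
  filter_upwards [ae_restrict_mem measurableSet_Ioo] with r hr
  have hr0 := hr.1
  rw [ENNReal.toReal_ofReal (by positivity), Real.norm_eq_abs, abs_of_nonneg (by positivity)]
  have h1 : ((φ : ℝ → ℝ) r) ^ 2 ≤ (C * r) ^ 2 := by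
    rw [← sq_abs]; gcongr; exact (hC r hr).2
  calc ((φ : ℝ → ℝ) r) ^ 2 * r⁻¹ ≤ (C * r) ^ 2 * r⁻¹ := by gcongr
    _ = C ^ 2 * r := by field_simp
    _ ≤ C ^ 2 * R := by gcongr; exact hr.2.le

/-- The Hilbert space `L²(r dr) × L²(r⁻¹ dr)` over `(0, R)`, with squared norm
`‖(g, u)‖² = ∫ r g² dr + ∫ r⁻¹ u² dr`. -/
abbrev PairSpace (R : ℝ) : Type :=
  WithLp 2 (Lp ℝ 2 (radialMeasure R) × Lp ℝ 2 (invRadialMeasure R))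

theorem ae_radial {R : ℝ} {p : ℝ → Prop} (h : ∀ r ∈ Ioo 0 R, p r) :
    ∀ᵐ r ∂(radialMeasure R), p r :=
  (withDensity_absolutelyContinuous _ _).ae_le
    ((ae_restrict_mem measurableSet_Ioo).mono h)

/-- The map `φ ↦ (φ', φ)`. It is an isometry from `X`, with the inner product
`(φ, ψ) = ∫ (r φ' ψ' + r⁻¹ φ ψ) dr`, onto its range. -/
def embed (R : ℝ) : testSpace R →ₗ[ℝ] PairSpace R where
  toFun φ := WithLp.toLp 2 ((testSpace_memLp_deriv φ).toLp _, (testSpace_memLp φ).toLp _)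
  map_add' φ ψ := by
    rw [← WithLp.toLp_add, Prod.mk_add_mk, ← MemLp.toLp_add, ← MemLp.toLp_add]
    congr 2
    rw [MemLp.toLp_eq_toLp_iff]
    exact ae_radial fun r hr =>
      ((testSpace_hasDerivAt φ hr).add (testSpace_hasDerivAt ψ hr)).deriv
  map_smul' c φ := by
    rw [RingHom.id_apply, ← WithLp.toLp_smul, Prod.smul_mk, ← MemLp.toLp_const_smul,
      ← MemLp.toLp_const_smul]
    congr 2
    rw [MemLp.toLp_eq_toLp_iff]
    exact ae_radial fun r hr => ((testSpace_hasDerivAt φ hr).const_smul c).deriv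

/-- The norm of the ambient space restricts on `X` to the norm of the stated inner product. -/
theorem inner_embed (R : ℝ) (φ ψ : testSpace R) :
    inner ℝ (embed R φ) (embed R ψ) = ∫ r in Ioo 0 R,
      (r * (deriv (φ : ℝ → ℝ) r * deriv (ψ : ℝ → ℝ) r) + r⁻¹ * ((φ : ℝ → ℝ) r * (ψ : ℝ → ℝ) r)) := by
  have e1 : ∫ r, deriv (φ : ℝ → ℝ) r * deriv (ψ : ℝ → ℝ) r ∂(radialMeasure R)
      = ∫ r in Ioo 0 R, r * (deriv (φ : ℝ → ℝ) r * deriv (ψ : ℝ → ℝ) r) := by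
    rw [radialMeasure, integral_withDensity_eq_integral_toReal_smul (by fun_prop) (by simp)]
    exact setIntegral_congr_fun measurableSet_Ioo fun r hr => by
      simp [ENNReal.toReal_ofReal hr.1.le]
  have e2 : ∫ r, (φ : ℝ → ℝ) r * (ψ : ℝ → ℝ) r ∂(invRadialMeasure R)
      = ∫ r in Ioo 0 R, r⁻¹ * ((φ : ℝ → ℝ) r * (ψ : ℝ → ℝ) r) := by
    rw [invRadialMeasure, integral_withDensity_eq_integral_toReal_smul (by fun_prop) (by simp)]
    exact setIntegral_congr_fun measurableSet_Ioo fun r hr => by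
      simp [ENNReal.toReal_ofReal (inv_nonneg.2 hr.1.le)]
  have i1 : Integrable (fun r => r * (deriv (φ : ℝ → ℝ) r * deriv (ψ : ℝ → ℝ) r))
      (volume.restrict (Ioo 0 R)) := by
    have h := (testSpace_memLp_deriv φ).integrable_mul (testSpace_memLp_deriv ψ)
    rw [radialMeasure, integrable_withDensity_iff_integrable_smul' (by fun_prop) (by simp)] at h
    refine h.congr ?_
    filter_upwards [ae_restrict_mem measurableSet_Ioo] with r hr
    simp [ENNReal.toReal_ofReal hr.1.le]
  have i2 : Integrable (fun r => r⁻¹ * ((φ : ℝ → ℝ) r * (ψ : ℝ → ℝ) r))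
      (volume.restrict (Ioo 0 R)) := by
    have h := (testSpace_memLp φ).integrable_mul (testSpace_memLp ψ)
    rw [invRadialMeasure, integrable_withDensity_iff_integrable_smul' (by fun_prop) (by simp)] at h
    refine h.congr ?_
    filter_upwards [ae_restrict_mem measurableSet_Ioo] with r hr
    simp [ENNReal.toReal_ofReal (inv_nonneg.2 hr.1.le)]
  rw [integral_add i1 i2, ← e1, ← e2, WithLp.prod_inner_apply, L2.inner_def, L2.inner_def]
  congr 1
  · refine integral_congr_ae ?_
    filter_upwards [(testSpace_memLp_deriv φ).coeFn_toLp, (testSpace_memLp_deriv ψ).coeFn_toLp]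
      with r h1 h2
    simp only [embed, LinearMap.coe_mk, AddHom.coe_mk]
    rw [h1, h2]; simp [mul_comm]
  · refine integral_congr_ae ?_
    filter_upwards [(testSpace_memLp φ).coeFn_toLp, (testSpace_memLp ψ).coeFn_toLp] with r h1 h2
    simp only [embed, LinearMap.coe_mk, AddHom.coe_mk]
    rw [h1, h2]; simp [mul_comm]

/-- The Hilbert space `H`: the completion of `X` for the inner product
`(u, v) = ∫ (r u' v' + r⁻¹ u v) dr`, realised as the closure of the isometric copy
`{(φ', φ) | φ ∈ X}` of `X` in a complete space. An element of `H` is thus a pair `(u', u)`. -/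
def HSpace (R : ℝ) : Submodule ℝ (PairSpace R) :=
  (LinearMap.range (embed R)).topologicalClosure

/-- The function `u` underlying an element of `H` (defined almost everywhere on `(0, R)`). -/
def hVal {R : ℝ} (U : HSpace R) : ℝ → ℝ := (U : PairSpace R).snd

/-- The derivative `u'` of an element of `H` (defined almost everywhere on `(0, R)`). -/
def hDer {R : ℝ} (U : HSpace R) : ℝ → ℝ := (U : PairSpace R).fst

/-- The action functional
`I_κ(u) = ½ ∫₀ᴿ (r u'² + (n²/r) u² - 2 (α⁻¹ - κ) r u² + 2 α⁻² r ln(1 + α u²)) dr` on `H`. -/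
def action (n : ℤ) (α κ R : ℝ) (U : HSpace R) : ℝ :=
  (1 / 2) * ∫ r in (0 : ℝ)..R,
    (r * hDer U r ^ 2 + (n : ℝ) ^ 2 / r * hVal U r ^ 2 - 2 * (α⁻¹ - κ) * r * hVal U r ^ 2
      + 2 * (α⁻¹) ^ 2 * r * Real.log (1 + α * hVal U r ^ 2))

/-- `γ_κ(u) = ½ ⟨I_κ'(u), u⟩
  = ½ ∫₀ᴿ (r u'² + (n²/r) u² - 2 (α⁻¹ - κ) r u² + 2 α⁻¹ r u² / (1 + α u²)) dr` on `H`. -/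
def nehariFunctional (n : ℤ) (α κ R : ℝ) (U : HSpace R) : ℝ :=
  (1 / 2) * ∫ r in (0 : ℝ)..R,
    (r * hDer U r ^ 2 + (n : ℝ) ^ 2 / r * hVal U r ^ 2 - 2 * (α⁻¹ - κ) * r * hVal U r ^ 2
      + 2 * α⁻¹ * (r * hVal U r ^ 2 / (1 + α * hVal U r ^ 2)))

/-- The Nehari manifold `{u ∈ H \ {0} | γ_κ(u) = 0}`. -/
def nehari (n : ℤ) (α κ R : ℝ) : Set (HSpace R) :=
  {U | U ≠ 0 ∧ nehariFunctional n α κ R U = 0}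

/-- `u` is a classical solution on `[0, R]` of the `n`-vortex equation
`(r u')' - (n²/r) u + 2 r u³ / (1 + α u²) - 2 κ r u = 0`, `u(0) = 0 = u(R)`. -/
structure IsVortexSolution (n : ℤ) (α κ R : ℝ) (u : ℝ → ℝ) : Prop where
  continuousOn : ContinuousOn u (Icc 0 R)
  contDiffOn : ContDiffOn ℝ 2 u (Ioo 0 R)
  equation : ∀ r ∈ Ioo 0 R,
    deriv (fun s => s * deriv u s) r - (n : ℝ) ^ 2 / r * u r
      + 2 * r * u r ^ 3 / (1 + α * u r ^ 2) - 2 * κ * r * u r = 0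
  zero_left : u 0 = 0
  zero_right : u R = 0

end Vortex

end

open MeasureTheory Set

noncomputable section

namespace Vortex

open Filter Topology
open scoped ContDiff

/-! Write q(u) = ∫ (r u'² + n² u²/r), P(u) = ∫ r u² and β = α⁻¹ - κ. Since 2uu' ≤ r u'² + u²/r, the
supremum of u is at most its norm in `H`. Bounded sequences therefore have weak limits along which
every ∫ r F(u), F continuous, converges by dominated convergence, while q is weakly lower
semicontinuous.

The nonlinearity saturates: along a ray, γ(tu)/t² goes from (q + 2κP)/2 at t = 0 to (q - 2βP)/2 as t
→ ∞. The first is positive by the Poincaré inequality with constant (n² + r₀²)/R² (`poincare`, by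
Picone's identity against J₀); the second is negative for an explicit polynomial once R is large
(`exists_qf_lt`). So the Nehari manifold is nonempty.

On it the action is α⁻² ∫ r (ln(1 + αu²) - αu²/(1 + αu²)), nondecreasing in |u|. This grows only
logarithmically, yet it controls P, because u² ≤ 2βP on the manifold forbids concentration
(`log_rint_sq_le`). Minimising sequences are thus bounded. Their weak limit is nonzero and has γ ≤
0; replacing it by its absolute value and scaling by some t ≤ 1 returns to the manifold without
raising the action (`exists_nonneg_minimiser`).

The action density is concave in u², so the action lies below a quadratic form touching it at the
minimiser. Comparison with t(U + sΦ) then gives the Euler-Lagrange equation with no information on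
how t depends on s. The Du Bois-Reymond lemma makes r u' a C¹ function, and uniqueness for the
resulting linear system excludes interior zeros. -/

/-! ### Weighted measures and the embedding of test functions -/

theorem ae_radial_iff {R : ℝ} {p : ℝ → Prop} :
    (∀ᵐ r ∂(radialMeasure R), p r) ↔ ∀ᵐ r ∂(volume.restrict (Ioo 0 R)), p r := by
  refine ⟨fun h => ?_, fun h => (withDensity_absolutelyContinuous _ _).ae_le h⟩
  refine (withDensity_absolutelyContinuous' (by fun_prop) ?_).ae_le h
  filter_upwards [ae_restrict_mem measurableSet_Ioo] with r hr
  simpa using hr.1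

theorem ae_invRadial_iff {R : ℝ} {p : ℝ → Prop} :
    (∀ᵐ r ∂(invRadialMeasure R), p r) ↔ ∀ᵐ r ∂(volume.restrict (Ioo 0 R)), p r := by
  refine ⟨fun h => ?_, fun h => (withDensity_absolutelyContinuous _ _).ae_le h⟩
  refine (withDensity_absolutelyContinuous' (by fun_prop) ?_).ae_le h
  filter_upwards [ae_restrict_mem measurableSet_Ioo] with r hr
  simpa using hr.1

theorem integrable_radial_iff {R : ℝ} {f : ℝ → ℝ} :
    Integrable f (radialMeasure R) ↔ IntegrableOn (fun r => r * f r) (Ioo 0 R) := by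
  rw [radialMeasure, integrable_withDensity_iff_integrable_smul' (by fun_prop) (by simp),
    IntegrableOn]
  refine integrable_congr ?_
  filter_upwards [ae_restrict_mem measurableSet_Ioo] with r hr
  simp [ENNReal.toReal_ofReal hr.1.le]

theorem integrable_invRadial_iff {R : ℝ} {f : ℝ → ℝ} :
    Integrable f (invRadialMeasure R) ↔ IntegrableOn (fun r => r⁻¹ * f r) (Ioo 0 R) := by
  rw [invRadialMeasure, integrable_withDensity_iff_integrable_smul' (by fun_prop) (by simp),
    IntegrableOn]
  refine integrable_congr ?_
  filter_upwards [ae_restrict_mem measurableSet_Ioo] with r hr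
  simp [ENNReal.toReal_ofReal (inv_nonneg.2 hr.1.le)]

theorem integral_radial (R : ℝ) (f : ℝ → ℝ) :
    ∫ r, f r ∂(radialMeasure R) = ∫ r in Ioo 0 R, r * f r := by
  rw [radialMeasure, integral_withDensity_eq_integral_toReal_smul (by fun_prop) (by simp)]
  exact setIntegral_congr_fun measurableSet_Ioo fun r hr => by
    simp [ENNReal.toReal_ofReal hr.1.le]

theorem integral_invRadial (R : ℝ) (f : ℝ → ℝ) :
    ∫ r, f r ∂(invRadialMeasure R) = ∫ r in Ioo 0 R, r⁻¹ * f r := by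
  rw [invRadialMeasure, integral_withDensity_eq_integral_toReal_smul (by fun_prop) (by simp)]
  exact setIntegral_congr_fun measurableSet_Ioo fun r hr => by
    simp [ENNReal.toReal_ofReal (inv_nonneg.2 hr.1.le)]

theorem integrableOn_radial_mul {R : ℝ} (f g : Lp ℝ 2 (radialMeasure R)) :
    IntegrableOn (fun r => r * (f r * g r)) (Ioo 0 R) :=
  integrable_radial_iff.1 ((Lp.memLp f).integrable_mul (Lp.memLp g))

theorem integrableOn_invRadial_mul {R : ℝ} (f g : Lp ℝ 2 (invRadialMeasure R)) :
    IntegrableOn (fun r => r⁻¹ * (f r * g r)) (Ioo 0 R) :=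
  integrable_invRadial_iff.1 ((Lp.memLp f).integrable_mul (Lp.memLp g))

theorem inner_radial {R : ℝ} (f g : Lp ℝ 2 (radialMeasure R)) :
    inner ℝ f g = ∫ r in Ioo 0 R, r * (f r * g r) := by
  rw [L2.inner_def, ← integral_radial R fun r => f r * g r]
  simp [mul_comm]

theorem inner_invRadial {R : ℝ} (f g : Lp ℝ 2 (invRadialMeasure R)) :
    inner ℝ f g = ∫ r in Ioo 0 R, r⁻¹ * (f r * g r) := by
  rw [L2.inner_def, ← integral_invRadial R fun r => f r * g r]
  simp [mul_comm]

/-- A `C¹` function as an element of `H`. -/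
def ofTest {R : ℝ} : testSpace R →ₗ[ℝ] HSpace R :=
  (embed R).codRestrict (HSpace R) fun φ => subset_closure ⟨φ, rfl⟩

theorem coe_ofTest {R : ℝ} (φ : testSpace R) : (ofTest φ : PairSpace R) = embed R φ := rfl

theorem hDer_ofTest {R : ℝ} (φ : testSpace R) :
    hDer (ofTest φ) =ᵐ[volume.restrict (Ioo 0 R)] deriv (φ : ℝ → ℝ) :=
  ae_radial_iff.1 (testSpace_memLp_deriv φ).coeFn_toLp

theorem hVal_ofTest {R : ℝ} (φ : testSpace R) :
    hVal (ofTest φ) =ᵐ[volume.restrict (Ioo 0 R)] (φ : ℝ → ℝ) :=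
  ae_invRadial_iff.1 (testSpace_memLp φ).coeFn_toLp

theorem exists_seq_ofTest {R : ℝ} (U : HSpace R) :
    ∃ φ : ℕ → testSpace R, Tendsto (fun k => ofTest (φ k)) atTop (𝓝 U) := by
  have hU : (U : PairSpace R) ∈ closure (LinearMap.range (embed R) : Set (PairSpace R)) := U.2
  obtain ⟨x, hx, hlim⟩ := mem_closure_iff_seq_limit.1 hU
  choose φ hφ using hx
  refine ⟨φ, tendsto_subtype_rng.2 ?_⟩
  simpa only [coe_ofTest, hφ] using hlim

/-! ### Continuous representatives and pointwise bounds -/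

/-- The continuous representative of an element of `H`, normalised to vanish at `R`. -/
def rep {R : ℝ} (U : HSpace R) (r : ℝ) : ℝ := -∫ s in r..R, hDer U s

/-- The inner product of this weight with u' in L²(s ds) is -∫_r^R u', so it represents evaluation
at r. The cutoff at s = r > 0 makes it bounded, hence square integrable. -/
theorem evalWeight_memLp {R r : ℝ} (hr : r ∈ Ioo 0 R) :
    MemLp (fun s => (Ioo r R).indicator (fun s => -s⁻¹) s) 2 (radialMeasure R) := by
  rw [memLp_two_iff_integrable_sq, integrable_radial_iff]
  · refine Measure.integrableOn_of_bounded (M := R * r⁻¹ ^ 2) (by simp) ?_ ?_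
    · exact Measurable.aestronglyMeasurable (measurable_id.mul
        (((measurable_inv.neg).indicator measurableSet_Ioo).pow_const 2))
    · filter_upwards [ae_restrict_mem measurableSet_Ioo] with s hs
      have h0 := hs.1
      have h1 := hr.1
      have h2 : 0 < R := h0.trans hs.2
      by_cases h : s ∈ Ioo r R
      · rw [indicator_of_mem h, Real.norm_eq_abs, abs_of_nonneg (by positivity), neg_sq]
        gcongr
        · exact hs.2.le
        · exact h.1.le
      · rw [indicator_of_notMem h]; simp; positivity
  · exact (measurable_inv.neg.indicator measurableSet_Ioo).aestronglyMeasurable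

theorem rep_eq_inner {R r : ℝ} (hr : r ∈ Ioo 0 R) (U : HSpace R) :
    rep U r = inner ℝ ((evalWeight_memLp hr).toLp _) (U : PairSpace R).fst := by
  have hsub : Ioo r R ⊆ Ioo 0 R := Ioo_subset_Ioo_left hr.1.le
  rw [inner_radial, rep, intervalIntegral.integral_of_le hr.2.le, integral_Ioc_eq_integral_Ioo,
    ← integral_neg, ← integral_indicator measurableSet_Ioo, ← integral_indicator measurableSet_Ioo]
  refine integral_congr_ae ?_
  have := ae_radial_iff.1 (evalWeight_memLp hr).coeFn_toLp
  rw [ae_restrict_iff' measurableSet_Ioo] at this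
  filter_upwards [this] with s hs
  by_cases h : s ∈ Ioo r R
  · have h0 : s ≠ 0 := ((hr.1).trans h.1).ne'
    rw [indicator_of_mem h, indicator_of_mem (hsub h), hs (hsub h), indicator_of_mem h]
    field_simp; rfl
  · rw [indicator_of_notMem h]
    by_cases h' : s ∈ Ioo 0 R
    · rw [indicator_of_mem h', hs h', indicator_of_notMem h]; simp
    · rw [indicator_of_notMem h']

/-- Evaluation at a point of `(0, R)` as a continuous linear functional on `H`. -/
def evalCLM {R r : ℝ} (hr : r ∈ Ioo 0 R) : HSpace R →L[ℝ] ℝ :=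
  (innerSL ℝ ((evalWeight_memLp hr).toLp _)).comp
    ((WithLp.fstL 2 ℝ _ _).comp (HSpace R).subtypeL)

theorem evalCLM_apply {R r : ℝ} (hr : r ∈ Ioo 0 R) (U : HSpace R) :
    evalCLM hr U = rep U r := (rep_eq_inner hr U).symm

theorem rep_add {R r : ℝ} (hr : r ∈ Ioo 0 R) (U V : HSpace R) :
    rep (U + V) r = rep U r + rep V r := by
  simp only [← evalCLM_apply hr, map_add]

theorem rep_sub {R r : ℝ} (hr : r ∈ Ioo 0 R) (U V : HSpace R) :
    rep (U - V) r = rep U r - rep V r := by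
  simp only [← evalCLM_apply hr, map_sub]

theorem rep_smul {R r : ℝ} (hr : r ∈ Ioo 0 R) (c : ℝ) (U : HSpace R) :
    rep (c • U) r = c * rep U r := by
  simp only [← evalCLM_apply hr, map_smul, smul_eq_mul]

theorem testSpace_intervalIntegrable_deriv {R : ℝ} (φ : testSpace R) {a b : ℝ} (hab : a ≤ b)
    (ha : 0 ≤ a) (hb : b ≤ R) : IntervalIntegrable (deriv (φ : ℝ → ℝ)) volume a b := by
  obtain ⟨C, hC⟩ := testSpace_deriv_bound φ
  rw [intervalIntegrable_iff_integrableOn_Ioo_of_le hab]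
  refine Measure.integrableOn_of_bounded (M := C) (by simp)
    (measurable_deriv _).aestronglyMeasurable ?_
  filter_upwards [ae_restrict_mem measurableSet_Ioo] with s hs
  exact hC s ⟨ha.trans_lt hs.1, hs.2.trans_le hb⟩

theorem rep_ofTest {R r : ℝ} (hr : r ∈ Ioo 0 R) (φ : testSpace R) :
    rep (ofTest φ) r = (φ : ℝ → ℝ) r := by
  have e : ∫ s in r..R, hDer (ofTest φ) s = ∫ s in r..R, deriv (φ : ℝ → ℝ) s := by
    rw [intervalIntegral.integral_of_le hr.2.le, intervalIntegral.integral_of_le hr.2.le,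
      integral_Ioc_eq_integral_Ioo, integral_Ioc_eq_integral_Ioo]
    exact integral_congr_ae
      (ae_restrict_of_ae_restrict_of_subset (Ioo_subset_Ioo_left hr.1.le) (hDer_ofTest φ))
  rw [rep, e, intervalIntegral.integral_eq_sub_of_hasDerivAt_of_le hr.2.le
    (φ.2.1.continuousOn.mono (Icc_subset_Icc_left hr.1.le))
    (fun s hs => testSpace_hasDerivAt φ ⟨hr.1.trans hs.1, hs.2⟩)
    (testSpace_intervalIntegrable_deriv φ hr.2.le hr.1.le le_rfl), φ.2.2.2]
  simp

theorem norm_sq_eq {R : ℝ} (U : HSpace R) :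
    ‖U‖ ^ 2 = ‖(U : PairSpace R).fst‖ ^ 2 + ‖(U : PairSpace R).snd‖ ^ 2 :=
  WithLp.prod_norm_sq_eq_of_L2 _

theorem normSq_fst {R : ℝ} (U : HSpace R) :
    ‖(U : PairSpace R).fst‖ ^ 2 = ∫ r in Ioo 0 R, r * hDer U r ^ 2 := by
  rw [← real_inner_self_eq_norm_sq, inner_radial]; simp only [sq]; rfl

theorem normSq_snd {R : ℝ} (U : HSpace R) :
    ‖(U : PairSpace R).snd‖ ^ 2 = ∫ r in Ioo 0 R, r⁻¹ * hVal U r ^ 2 := by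
  rw [← real_inner_self_eq_norm_sq, inner_invRadial]; simp only [sq]; rfl

theorem integrableOn_hDer_sq {R : ℝ} (U : HSpace R) :
    IntegrableOn (fun r => r * hDer U r ^ 2) (Ioo 0 R) := by
  simp only [sq]
  exact integrableOn_radial_mul (U : PairSpace R).fst (U : PairSpace R).fst

theorem integrableOn_hVal_sq {R : ℝ} (U : HSpace R) :
    IntegrableOn (fun r => r⁻¹ * hVal U r ^ 2) (Ioo 0 R) := by
  simp only [sq]
  exact integrableOn_invRadial_mul (U : PairSpace R).snd (U : PairSpace R).snd

/-- Because φ(0) = 0, φ(r)² = ∫₀^r 2φφ', and s φ'² + φ²/s - 2φφ' = (sφ' - φ)²/s ≥ 0. -/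
theorem abs_testSpace_le {R r : ℝ} (hr : r ∈ Ioo 0 R) (φ : testSpace R) :
    |(φ : ℝ → ℝ) r| ≤ ‖ofTest φ‖ := by
  refine abs_le_of_sq_le_sq ?_ (norm_nonneg _)
  have hc : ContinuousOn (φ : ℝ → ℝ) (Icc 0 r) :=
    φ.2.1.continuousOn.mono (Icc_subset_Icc_right hr.2.le)
  have hi : IntervalIntegrable (fun s => 2 * ((φ : ℝ → ℝ) s * deriv (φ : ℝ → ℝ) s)) volume 0 r := by
    refine ((testSpace_intervalIntegrable_deriv φ hr.1.le le_rfl hr.2.le).continuousOn_mul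
      ?_).const_mul 2
    rwa [uIcc_of_le hr.1.le]
  have e : ∫ s in (0 : ℝ)..r, 2 * ((φ : ℝ → ℝ) s * deriv (φ : ℝ → ℝ) s)
      = (φ : ℝ → ℝ) r ^ 2 := by
    rw [intervalIntegral.integral_eq_sub_of_hasDerivAt_of_le (f := fun s => (φ : ℝ → ℝ) s ^ 2)
      hr.1.le (hc.pow 2) (fun s hs => ?_) hi, φ.2.2.1]
    · simp
    · convert! (testSpace_hasDerivAt φ ⟨hs.1, hs.2.trans hr.2⟩).pow 2 using 1
      simp; ring
  have hsum := (integrableOn_hDer_sq (ofTest φ)).add (integrableOn_hVal_sq (ofTest φ))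
  have hsub : Ioo 0 r ⊆ Ioo 0 R := Ioo_subset_Ioo_right hr.2.le
  rw [← e, norm_sq_eq, normSq_fst, normSq_snd, ← integral_add (integrableOn_hDer_sq (ofTest φ))
    (integrableOn_hVal_sq (ofTest φ)), intervalIntegral.integral_of_le hr.1.le,
    integral_Ioc_eq_integral_Ioo]
  refine le_trans (setIntegral_mono_ae_restrict
    ((intervalIntegrable_iff_integrableOn_Ioo_of_le hr.1.le).1 hi) (hsum.mono_set hsub) ?_)
    (setIntegral_mono_set hsum ?_ (ae_of_all _ hsub))
  · filter_upwards [ae_restrict_of_ae_restrict_of_subset hsub (hDer_ofTest φ),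
      ae_restrict_of_ae_restrict_of_subset hsub (hVal_ofTest φ),
      ae_restrict_mem measurableSet_Ioo] with s h1 h2 hs
    simp only [Pi.add_apply]
    rw [h1, h2]
    have h0 := hs.1
    have : s * deriv (φ : ℝ → ℝ) s ^ 2 + s⁻¹ * (φ : ℝ → ℝ) s ^ 2
        - 2 * ((φ : ℝ → ℝ) s * deriv (φ : ℝ → ℝ) s)
        = s⁻¹ * (s * deriv (φ : ℝ → ℝ) s - (φ : ℝ → ℝ) s) ^ 2 := by
      field_simp; ring
    have h3 : 0 ≤ s⁻¹ * (s * deriv (φ : ℝ → ℝ) s - (φ : ℝ → ℝ) s) ^ 2 := by positivity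
    linarith
  · filter_upwards [ae_restrict_mem measurableSet_Ioo] with s hs
    have h0 := hs.1
    simp only [Pi.zero_apply, Pi.add_apply]
    positivity

theorem abs_rep_le {R r : ℝ} (hr : r ∈ Ioo 0 R) (U : HSpace R) : |rep U r| ≤ ‖U‖ := by
  obtain ⟨φ, hφ⟩ := exists_seq_ofTest U
  have h1 := ((evalCLM hr).continuous.tendsto U).comp hφ
  rw [← evalCLM_apply hr]
  refine le_of_tendsto_of_tendsto h1.abs hφ.norm (Eventually.of_forall fun k => ?_)
  simp only [Function.comp_apply, evalCLM_apply, rep_ofTest hr]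
  exact abs_testSpace_le hr _

/-- Both sides are limits of the same test functions: the left one almost everywhere along a
subsequence of an L² limit, the right one pointwise by continuity of evaluation. -/
theorem hVal_ae_eq_rep {R : ℝ} (U : HSpace R) :
    hVal U =ᵐ[volume.restrict (Ioo 0 R)] rep U := by
  obtain ⟨φ, hφ⟩ := exists_seq_ofTest U
  have h1 : Tendsto (fun k => (ofTest (φ k) : PairSpace R).snd) atTop
      (𝓝 (U : PairSpace R).snd) :=
    (((WithLp.sndL 2 ℝ _ _).comp (HSpace R).subtypeL).continuous.tendsto U).comp hφ
  obtain ⟨ns, hns, h2⟩ := (tendstoInMeasure_of_tendsto_Lp h1).exists_seq_tendsto_ae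
  have h3 := ae_invRadial_iff.1 h2
  have h4 : ∀ᵐ r ∂(volume.restrict (Ioo 0 R)), ∀ k, hVal (ofTest (φ k)) r = (φ k : ℝ → ℝ) r :=
    ae_all_iff.2 fun k => hVal_ofTest (φ k)
  filter_upwards [h3, h4, ae_restrict_mem measurableSet_Ioo] with r h5 h6 hr
  have h7 := (((evalCLM hr).continuous.tendsto U).comp hφ).comp hns.tendsto_atTop
  refine tendsto_nhds_unique h5 ?_
  refine (h7.congr fun k => ?_).trans_eq (by rw [evalCLM_apply])
  simp only [Function.comp_apply, evalCLM_apply, rep_ofTest hr]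
  exact (h6 _).symm

theorem intervalIntegrable_hDer {R : ℝ} (U : HSpace R) {a : ℝ} (ha : 0 < a) (haR : a ≤ R) :
    IntervalIntegrable (hDer U) volume a R := by
  rcases haR.eq_or_lt with rfl | haR'
  · exact IntervalIntegrable.refl
  have h := integrableOn_radial_mul ((evalWeight_memLp ⟨ha, haR'⟩).toLp _) (U : PairSpace R).fst
  rw [intervalIntegrable_iff_integrableOn_Ioo_of_le haR]
  have hsub : Ioo a R ⊆ Ioo 0 R := Ioo_subset_Ioo_left ha.le
  refine ((h.mono_set hsub).neg).congr ?_
  filter_upwards [ae_restrict_of_ae_restrict_of_subset hsub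
    (ae_radial_iff.1 (evalWeight_memLp ⟨ha, haR'⟩).coeFn_toLp),
    ae_restrict_mem measurableSet_Ioo] with s h1 hs
  have h0 : s ≠ 0 := (ha.trans hs.1).ne'
  simp only [Pi.neg_apply]
  rw [h1, indicator_of_mem hs]
  field_simp; rfl

theorem continuousOn_rep_Ioc {R : ℝ} (U : HSpace R) : ContinuousOn (rep U) (Ioc 0 R) := by
  intro r hr
  have ha : 0 < r / 2 := half_pos hr.1
  have haR : r / 2 ≤ R := (half_le_self hr.1.le).trans hr.2
  have h := intervalIntegral.continuousOn_primitive_interval_left (μ := volume) (f := hDer U)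
    (a := r / 2) (b := R) ?_
  · have h1 := (h.neg) r (by rw [uIcc_of_le haR]; exact ⟨half_le_self hr.1.le, hr.2⟩)
    rw [uIcc_of_le haR] at h1
    refine h1.mono_of_mem_nhdsWithin ?_
    filter_upwards [self_mem_nhdsWithin, mem_nhdsWithin_of_mem_nhds
      (Ioi_mem_nhds (half_lt_self hr.1))] with s hs hs'
    exact ⟨(mem_Ioi.1 hs').le, hs.2⟩
  · rw [← intervalIntegrable_iff']
    exact intervalIntegrable_hDer U ha haR

theorem measurable_rep_restrict {R : ℝ} (U : HSpace R) :
    AEStronglyMeasurable (rep U) (volume.restrict (Ioo 0 R)) :=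
  ((continuousOn_rep_Ioc U).mono Ioo_subset_Ioc_self).aestronglyMeasurable measurableSet_Ioo

theorem rep_right {R : ℝ} (U : HSpace R) : rep U R = 0 := by simp [rep]

/-- Convergence in `H` is uniform on (0, R) by `abs_rep_le`, so the boundary value of the
approximating test functions survives. -/
theorem tendsto_rep_zero {R : ℝ} (hR : 0 < R) (U : HSpace R) :
    Tendsto (rep U) (𝓝[>] 0) (𝓝 0) := by
  rw [Metric.tendsto_nhds]
  intro ε hε
  obtain ⟨φ, hφ⟩ := exists_seq_ofTest U
  obtain ⟨k, hk⟩ := ((Metric.tendsto_nhds.1 hφ) (ε / 2) (half_pos hε)).exists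
  have hc : Tendsto (φ k : ℝ → ℝ) (𝓝[>] 0) (𝓝 0) := by
    have h := (φ k).2.1.continuousOn 0 ⟨le_rfl, hR.le⟩
    rw [ContinuousWithinAt, (φ k).2.2.1] at h
    refine h.mono_left (nhdsWithin_le_of_mem ?_)
    exact mem_of_superset (Ioo_mem_nhdsGT hR) Ioo_subset_Icc_self
  filter_upwards [Metric.tendsto_nhds.1 hc _ (half_pos hε), Ioo_mem_nhdsGT hR] with r h1 h2
  have h3 := abs_rep_le h2 (ofTest (φ k) - U)
  rw [rep_sub h2, rep_ofTest h2, ← dist_eq_norm] at h3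
  rw [Real.dist_eq, sub_zero] at *
  have := abs_sub_abs_le_abs_sub (rep U r) ((φ k : ℝ → ℝ) r)
  rw [abs_sub_comm] at this
  linarith

/-! ### The quadratic form and the radial integrals of nonlinearities -/

/-- The bilinear form `∫₀ᴿ (r u' v' + (n²/r) u v) dr` on `H`. -/
def qf (n : ℤ) {R : ℝ} (U V : HSpace R) : ℝ :=
  inner ℝ (U : PairSpace R).fst (V : PairSpace R).fst
    + (n : ℝ) ^ 2 * inner ℝ (U : PairSpace R).snd (V : PairSpace R).snd

theorem qf_comm (n : ℤ) {R : ℝ} (U V : HSpace R) : qf n U V = qf n V U := by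
  simp only [qf, real_inner_comm]

theorem qf_add_left (n : ℤ) {R : ℝ} (U V W : HSpace R) : qf n (U + V) W = qf n U W + qf n V W := by
  simp only [qf, Submodule.coe_add, WithLp.add_fst, WithLp.add_snd, inner_add_left]; ring

theorem qf_smul_left (n : ℤ) {R : ℝ} (c : ℝ) (U V : HSpace R) : qf n (c • U) V = c * qf n U V := by
  simp only [qf, Submodule.coe_smul, WithLp.smul_fst, WithLp.smul_snd, real_inner_smul_left]; ring

theorem qf_add_right (n : ℤ) {R : ℝ} (U V W : HSpace R) : qf n W (U + V) = qf n W U + qf n W V := by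
  rw [qf_comm, qf_add_left, qf_comm n U, qf_comm n V]

theorem qf_smul_right (n : ℤ) {R : ℝ} (c : ℝ) (U V : HSpace R) : qf n V (c • U) = c * qf n V U := by
  rw [qf_comm, qf_smul_left, qf_comm]

theorem qf_self (n : ℤ) {R : ℝ} (U : HSpace R) :
    qf n U U = ‖(U : PairSpace R).fst‖ ^ 2 + (n : ℝ) ^ 2 * ‖(U : PairSpace R).snd‖ ^ 2 := by
  simp only [qf, real_inner_self_eq_norm_sq]

theorem qf_self_nonneg (n : ℤ) {R : ℝ} (U : HSpace R) : 0 ≤ qf n U U := by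
  rw [qf_self]; positivity

theorem one_le_sq_of_one_le_abs {n : ℤ} (hn : 1 ≤ |n|) : (1 : ℝ) ≤ (n : ℝ) ^ 2 := by
  have : (1 : ℤ) ≤ n ^ 2 := by rw [← sq_abs]; nlinarith
  exact_mod_cast this

theorem norm_sq_le_qf {n : ℤ} (hn : 1 ≤ |n|) {R : ℝ} (U : HSpace R) : ‖U‖ ^ 2 ≤ qf n U U := by
  rw [qf_self, norm_sq_eq]
  have := mul_le_mul_of_nonneg_right (one_le_sq_of_one_le_abs hn)
    (sq_nonneg ‖(U : PairSpace R).snd‖)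
  linarith

theorem continuous_qf_self (n : ℤ) (R : ℝ) : Continuous fun U : HSpace R => qf n U U := by
  unfold qf; fun_prop

/-- `qf n U` as a continuous linear functional. -/
def qfCLM (n : ℤ) {R : ℝ} (U : HSpace R) : HSpace R →L[ℝ] ℝ :=
  ((innerSL ℝ (U : PairSpace R).fst).comp ((WithLp.fstL 2 ℝ _ _).comp (HSpace R).subtypeL))
    + (n : ℝ) ^ 2 •
      ((innerSL ℝ (U : PairSpace R).snd).comp ((WithLp.sndL 2 ℝ _ _).comp (HSpace R).subtypeL))

theorem qf_sub_self (n : ℤ) {R : ℝ} (U V : HSpace R) :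
    qf n (U - V) (U - V) = qf n U U - 2 * qf n V U + qf n V V := by
  have h : U - V = U + (-1 : ℝ) • V := by simp [sub_eq_add_neg]
  rw [h]
  simp only [qf_add_left, qf_add_right, qf_smul_left, qf_smul_right, qf_comm n U V]; ring

/-- Weak limits do not increase the quadratic form. -/
theorem qf_le_of_tendsto (n : ℤ) {R : ℝ} {U : ℕ → HSpace R} {V : HSpace R} {c : ℕ → ℝ} {C : ℝ}
    (hU : ∀ ℓ : HSpace R →L[ℝ] ℝ, Tendsto (fun k => ℓ (U k)) atTop (𝓝 (ℓ V)))
    (hc : ∀ k, qf n (U k) (U k) ≤ c k) (hC : Tendsto c atTop (𝓝 C)) : qf n V V ≤ C := by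
  have h1 : Tendsto (fun k => c k - 2 * qf n V (U k) + qf n V V) atTop
      (𝓝 (C - 2 * qf n V V + qf n V V)) :=
    (hC.sub ((hU (qfCLM n V)).const_mul 2)).add_const _
  have h2 := ge_of_tendsto' h1 (b := 0) fun k => by
    have := qf_self_nonneg n (U k - V)
    rw [qf_sub_self] at this
    linarith [hc k]
  linarith

/-- The radial integral `∫₀ᴿ r F(u) dr` of a nonlinearity. -/
def rint {R : ℝ} (F : ℝ → ℝ) (U : HSpace R) : ℝ := ∫ r in Ioo 0 R, r * F (rep U r)

theorem integrableOn_radial_comp₂ {R : ℝ} {F : ℝ × ℝ → ℝ} (hF : Continuous F) (U V : HSpace R) :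
    IntegrableOn (fun r => r * F (rep U r, rep V r)) (Ioo 0 R) := by
  obtain ⟨C, hC⟩ := (isCompact_Icc.prod isCompact_Icc :
    IsCompact (Icc (-‖U‖) ‖U‖ ×ˢ Icc (-‖V‖) ‖V‖)).exists_bound_of_continuousOn hF.continuousOn
  refine Integrable.of_bound ?_ (R * C) ?_
  · exact measurable_id.aestronglyMeasurable.mul (hF.comp_aestronglyMeasurable
      ((measurable_rep_restrict U).prodMk (measurable_rep_restrict V)))
  · filter_upwards [ae_restrict_mem measurableSet_Ioo] with r hr
    have h := hC (rep U r, rep V r) ⟨abs_le.1 (abs_rep_le hr U), abs_le.1 (abs_rep_le hr V)⟩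
    rw [norm_mul, Real.norm_eq_abs, abs_of_pos hr.1]
    exact mul_le_mul hr.2.le h (norm_nonneg _) (hr.1.trans hr.2).le

theorem integrableOn_radial_comp {R : ℝ} {F : ℝ → ℝ} (hF : Continuous F) (U : HSpace R) :
    IntegrableOn (fun r => r * F (rep U r)) (Ioo 0 R) :=
  integrableOn_radial_comp₂ (F := fun p => F p.1) (by fun_prop) U U

/-- This plays the role of a compact embedding: a norm bound is a uniform bound, so pointwise
convergence suffices by dominated convergence. -/
theorem tendsto_rint {R : ℝ} {F : ℝ → ℝ} (hF : Continuous F) {U : ℕ → HSpace R} {V : HSpace R}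
    {C : ℝ} (hC : ∀ k, ‖U k‖ ≤ C)
    (hU : ∀ r ∈ Ioo 0 R, Tendsto (fun k => rep (U k) r) atTop (𝓝 (rep V r))) :
    Tendsto (fun k => rint F (U k)) atTop (𝓝 (rint F V)) := by
  obtain ⟨M, hM⟩ := (isCompact_Icc (a := -C) (b := C)).exists_bound_of_continuousOn
    hF.continuousOn
  refine tendsto_integral_of_dominated_convergence (fun _ => R * M)
    (fun k => (integrableOn_radial_comp hF (U k)).aestronglyMeasurable)
    (integrable_const _) (fun k => ?_) ?_
  · filter_upwards [ae_restrict_mem measurableSet_Ioo] with r hr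
    have h := hM (rep (U k) r) (abs_le.1 ((abs_rep_le hr (U k)).trans (hC k)))
    rw [norm_mul, Real.norm_eq_abs, abs_of_pos hr.1]
    exact mul_le_mul hr.2.le h (norm_nonneg _) (hr.1.trans hr.2).le
  · filter_upwards [ae_restrict_mem measurableSet_Ioo] with r hr
    exact ((hF.tendsto _).comp (hU r hr)).const_mul r

theorem rint_mono {R : ℝ} {F G : ℝ → ℝ} (hF : Continuous F) (hG : Continuous G) (U V : HSpace R)
    (h : ∀ r ∈ Ioo 0 R, F (rep U r) ≤ G (rep V r)) : rint F U ≤ rint G V := by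
  refine setIntegral_mono_on (integrableOn_radial_comp hF U) (integrableOn_radial_comp hG V)
    measurableSet_Ioo fun r hr => ?_
  have := hr.1
  have := h r hr
  gcongr

theorem rint_sq_smul {R : ℝ} (c : ℝ) (U : HSpace R) :
    rint (· ^ 2) (c • U) = c ^ 2 * rint (· ^ 2) U := by
  rw [rint, rint, ← integral_const_mul]
  refine setIntegral_congr_fun measurableSet_Ioo fun r hr => ?_
  simp only [rep_smul hr]; ring

theorem rint_sq_nonneg {R : ℝ} (U : HSpace R) : 0 ≤ rint (· ^ 2) U :=
  setIntegral_nonneg measurableSet_Ioo fun _ hr => mul_nonneg hr.1.le (sq_nonneg _)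

theorem integral_radial_one {R : ℝ} (hR : 0 ≤ R) : ∫ r in Ioo 0 R, r = R ^ 2 / 2 := by
  rw [← integral_Ioc_eq_integral_Ioo, ← intervalIntegral.integral_of_le hR, integral_id]; simp

theorem continuous_saturation {α : ℝ} (hα : 0 < α) :
    Continuous fun x : ℝ => x ^ 2 / (1 + α * x ^ 2) :=
  (continuous_pow 2).div (by fun_prop) fun x => by positivity

theorem continuous_log_sq {α : ℝ} (hα : 0 < α) :
    Continuous fun x : ℝ => Real.log (1 + α * x ^ 2) :=
  Continuous.log (by fun_prop) fun x => by positivity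

theorem integral_common {n : ℤ} {α κ R : ℝ} (hR : 0 < R) {F : ℝ → ℝ} (hF : Continuous F)
    (U : HSpace R) :
    ∫ r in (0 : ℝ)..R, (r * hDer U r ^ 2 + (n : ℝ) ^ 2 / r * hVal U r ^ 2
      - 2 * (α⁻¹ - κ) * r * hVal U r ^ 2 + r * F (hVal U r))
    = qf n U U - 2 * (α⁻¹ - κ) * rint (· ^ 2) U + rint F U := by
  have e1 : IntegrableOn (fun r => (n : ℝ) ^ 2 * (r⁻¹ * hVal U r ^ 2)) (Ioo 0 R) :=
    (integrableOn_hVal_sq U).const_mul _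
  have e2 : IntegrableOn (fun r => 2 * (α⁻¹ - κ) * (r * rep U r ^ 2)) (Ioo 0 R) :=
    (integrableOn_radial_comp (continuous_pow 2) U).const_mul _
  have e3 := integrableOn_radial_comp hF U
  rw [qf_self, normSq_fst, normSq_snd, rint, rint, ← integral_const_mul, ← integral_const_mul,
    ← integral_add (integrableOn_hDer_sq U) e1, ← integral_sub _ e2, ← integral_add _ e3,
    intervalIntegral.integral_of_le hR.le, integral_Ioc_eq_integral_Ioo]
  · refine integral_congr_ae ?_
    filter_upwards [hVal_ae_eq_rep U] with r hr
    rw [hr]; ring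
  · exact ((integrableOn_hDer_sq U).add e1).sub e2
  · exact (integrableOn_hDer_sq U).add e1

theorem rint_const_mul {R : ℝ} (c : ℝ) (F : ℝ → ℝ) (U : HSpace R) :
    rint (fun x => c * F x) U = c * rint F U := by
  rw [rint, rint, ← integral_const_mul]
  simp only [mul_left_comm]

theorem action_eq (n : ℤ) {α : ℝ} (κ : ℝ) {R : ℝ} (hα : 0 < α) (hR : 0 < R) (U : HSpace R) :
    action n α κ R U = 1 / 2 * (qf n U U - 2 * (α⁻¹ - κ) * rint (· ^ 2) U
      + 2 * α⁻¹ ^ 2 * rint (fun x => Real.log (1 + α * x ^ 2)) U) := by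
  rw [action, ← rint_const_mul (2 * α⁻¹ ^ 2), ← integral_common hR (by have := continuous_log_sq hα; fun_prop)]
  congr 2; ext r; ring

theorem nehariFunctional_eq (n : ℤ) {α : ℝ} (κ : ℝ) {R : ℝ} (hα : 0 < α) (hR : 0 < R)
    (U : HSpace R) :
    nehariFunctional n α κ R U = 1 / 2 * (qf n U U - 2 * (α⁻¹ - κ) * rint (· ^ 2) U
      + 2 * α⁻¹ * rint (fun x => x ^ 2 / (1 + α * x ^ 2)) U) := by
  rw [nehariFunctional, ← rint_const_mul (2 * α⁻¹),
    ← integral_common hR (by have := continuous_saturation hα; fun_prop)]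
  congr 2; ext r; ring

/-! ### Weak compactness and absolute values -/

/-- Bounded sequences in a separable Hilbert space have weakly convergent subsequences. -/
theorem exists_weak_subseq {E : Type*} [NormedAddCommGroup E] [InnerProductSpace ℝ E]
    [CompleteSpace E] [TopologicalSpace.SeparableSpace E] {x : ℕ → E} {C : ℝ}
    (hx : ∀ k, ‖x k‖ ≤ C) :
    ∃ (y : E) (σ : ℕ → ℕ), StrictMono σ ∧
      ∀ ℓ : E →L[ℝ] ℝ, Tendsto (fun k => ℓ (x (σ k))) atTop (𝓝 (ℓ y)) := by
  obtain ⟨g, -, σ, hσ, hg⟩ := (WeakDual.isSeqCompact_closedBall ℝ E 0 C)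
    (x := fun k => StrongDual.toWeakDual (InnerProductSpace.toDual ℝ E (x k))) (fun k => by
      simpa using hx k)
  refine ⟨(InnerProductSpace.toDual ℝ E).symm (WeakDual.toStrongDual g), σ, hσ, fun ℓ => ?_⟩
  have h := ((WeakDual.eval_continuous ((InnerProductSpace.toDual ℝ E).symm ℓ)).tendsto g).comp hg
  have e : ∀ z, ℓ z = inner ℝ z ((InnerProductSpace.toDual ℝ E).symm ℓ) := fun z => by
    rw [real_inner_comm, InnerProductSpace.toDual_symm_apply]
  rw [e, InnerProductSpace.toDual_symm_apply]
  refine h.congr fun k => ?_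
  rw [e]; rfl

instance (R : ℝ) : SFinite (radialMeasure R) := by unfold radialMeasure; infer_instance

instance (R : ℝ) : SFinite (invRadialMeasure R) := by unfold invRadialMeasure; infer_instance

instance (R : ℝ) : SecondCountableTopology (PairSpace R) := by
  have : Fact ((2 : ENNReal) ≠ ⊤) := ⟨by simp⟩
  infer_instance

instance (R : ℝ) : CompleteSpace (HSpace R) :=
  (Submodule.isClosed_topologicalClosure _).completeSpace_coe

theorem exists_weak_subseq_H {R : ℝ} {U : ℕ → HSpace R} {C : ℝ} (hU : ∀ k, ‖U k‖ ≤ C) :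
    ∃ (V : HSpace R) (σ : ℕ → ℕ), StrictMono σ ∧
      ∀ ℓ : HSpace R →L[ℝ] ℝ, Tendsto (fun k => ℓ (U (σ k))) atTop (𝓝 (ℓ V)) :=
  exists_weak_subseq hU

theorem tendsto_rep_of_weak {R : ℝ} {U : ℕ → HSpace R} {V : HSpace R}
    (h : ∀ ℓ : HSpace R →L[ℝ] ℝ, Tendsto (fun k => ℓ (U k)) atTop (𝓝 (ℓ V))) :
    ∀ r ∈ Ioo 0 R, Tendsto (fun k => rep (U k) r) atTop (𝓝 (rep V r)) := fun r hr => by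
  simpa only [evalCLM_apply] using h (evalCLM hr)

/-- The smooth approximation `√(φ² + ε²) - ε` of `|φ|`. -/
def smoothAbs {R ε : ℝ} (hε : 0 < ε) (φ : testSpace R) : testSpace R :=
  ⟨fun r => Real.sqrt ((φ : ℝ → ℝ) r ^ 2 + ε ^ 2) - ε,
    (((φ.2.1.pow 2).add contDiffOn_const).sqrt fun r _ => by positivity).sub contDiffOn_const,
    by simp [φ.2.2.1, hε.le], by simp [φ.2.2.2, hε.le]⟩

theorem smoothAbs_apply {R ε : ℝ} (hε : 0 < ε) (φ : testSpace R) (r : ℝ) :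
    (smoothAbs hε φ : ℝ → ℝ) r = Real.sqrt ((φ : ℝ → ℝ) r ^ 2 + ε ^ 2) - ε := rfl

theorem abs_sqrt_sq_add_sub_le {x ε : ℝ} (hε : 0 < ε) :
    |Real.sqrt (x ^ 2 + ε ^ 2) - ε - (|x|)| ≤ ε := by
  have h1 : Real.sqrt (x ^ 2 + ε ^ 2) ≤ |x| + ε := by
    refine Real.sqrt_le_iff.2 ⟨by positivity, ?_⟩
    nlinarith [sq_abs x, abs_nonneg x]
  have h2 : |x| ≤ Real.sqrt (x ^ 2 + ε ^ 2) := Real.abs_le_sqrt (by nlinarith)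
  rw [abs_le]; constructor <;> linarith

/-- Both terms decrease pointwise: the derivative φφ'/√(φ² + ε²) is at most |φ'| in modulus, and 0 ≤
√(φ² + ε²) - ε ≤ |φ|. -/
theorem qf_smoothAbs_le (n : ℤ) {R ε : ℝ} (hε : 0 < ε) (φ : testSpace R) :
    qf n (ofTest (smoothAbs hε φ)) (ofTest (smoothAbs hε φ)) ≤ qf n (ofTest φ) (ofTest φ) := by
  simp only [qf_self, normSq_fst, normSq_snd]
  gcongr ?_ + _ * ?_
  · refine setIntegral_mono_ae_restrict (integrableOn_hDer_sq _) (integrableOn_hDer_sq _) ?_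
    filter_upwards [hDer_ofTest φ, hDer_ofTest (smoothAbs hε φ),
      ae_restrict_mem measurableSet_Ioo] with r h1 h2 hr
    rw [h1, h2]
    have h0 := hr.1
    have hp : 0 < (φ : ℝ → ℝ) r ^ 2 + ε ^ 2 := by positivity
    have hd : HasDerivAt (smoothAbs hε φ : ℝ → ℝ) _ r :=
      ((((testSpace_hasDerivAt φ hr).pow 2).add_const (ε ^ 2)).sqrt hp.ne').sub_const ε
    rw [hd.deriv]
    gcongr r * ?_
    have hs := Real.sq_sqrt hp.le
    simp only [Pi.pow_apply]
    rw [div_pow, div_le_iff₀ (by positivity), mul_pow 2 (Real.sqrt _), hs]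
    norm_num
    nlinarith [mul_nonneg (sq_nonneg (deriv (φ : ℝ → ℝ) r)) (sq_nonneg ε)]
  · refine setIntegral_mono_ae_restrict (integrableOn_hVal_sq _) (integrableOn_hVal_sq _) ?_
    filter_upwards [hVal_ofTest φ, hVal_ofTest (smoothAbs hε φ),
      ae_restrict_mem measurableSet_Ioo] with r h1 h2 hr
    rw [h1, h2, smoothAbs_apply]
    have h0 := hr.1
    gcongr r⁻¹ * ?_
    have hp : 0 ≤ (φ : ℝ → ℝ) r ^ 2 + ε ^ 2 := by positivity
    have h3 : ε ≤ Real.sqrt ((φ : ℝ → ℝ) r ^ 2 + ε ^ 2) := Real.le_sqrt_of_sq_le (by nlinarith)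
    nlinarith [Real.sq_sqrt hp]

/-- `H` is stable under absolute values, which do not increase the quadratic form. -/
theorem exists_abs {n : ℤ} (hn : 1 ≤ |n|) {R : ℝ} (U : HSpace R) :
    ∃ V : HSpace R, (∀ r ∈ Ioo 0 R, rep V r = |rep U r|) ∧ qf n V V ≤ qf n U U := by
  obtain ⟨φ, hφ⟩ := exists_seq_ofTest U
  have hε : ∀ k : ℕ, 0 < 1 / ((k : ℝ) + 1) := fun k => by positivity
  have hq : Tendsto (fun k => qf n (ofTest (φ k)) (ofTest (φ k))) atTop (𝓝 (qf n U U)) :=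
    ((continuous_qf_self n R).tendsto U).comp hφ
  obtain ⟨C, hC⟩ := hq.bddAbove_range
  -- The quadratic form dominates the squared norm, so the smoothed functions are bounded in `H`. A
  -- weak limit as ε → 0 then provides the absolute value as an element of `H`.
  have hb : ∀ k, ‖ofTest (smoothAbs (hε k) (φ k))‖ ≤ Real.sqrt C := fun k =>
    Real.le_sqrt_of_sq_le <| (norm_sq_le_qf hn _).trans <|
      (qf_smoothAbs_le n (hε k) (φ k)).trans (hC ⟨k, rfl⟩)
  obtain ⟨V, σ, hσ, hV⟩ := exists_weak_subseq_H hb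
  refine ⟨V, fun r hr => ?_, qf_le_of_tendsto n hV
    (fun k => qf_smoothAbs_le n (hε (σ k)) (φ (σ k))) (hq.comp hσ.tendsto_atTop)⟩
  refine tendsto_nhds_unique (tendsto_rep_of_weak hV r hr) ?_
  have h1 : Tendsto (fun k => |rep (ofTest (φ k)) r|) atTop (𝓝 |rep U r|) := by
    have := (((evalCLM hr).continuous.tendsto U).comp hφ).abs
    simpa only [Function.comp_def, evalCLM_apply] using this
  have h2 : Tendsto (fun k => rep (ofTest (smoothAbs (hε k) (φ k))) r
      - |rep (ofTest (φ k)) r|) atTop (𝓝 0) := by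
    refine squeeze_zero_norm (fun k => ?_) tendsto_one_div_add_atTop_nhds_zero_nat
    rw [rep_ofTest hr, rep_ofTest hr, smoothAbs_apply, Real.norm_eq_abs]
    exact abs_sqrt_sq_add_sub_le (hε k)
  have h3 := h2.add h1
  simp only [sub_add_cancel, zero_add] at h3
  exact h3.comp hσ.tendsto_atTop

theorem continuous_rint {R : ℝ} {F : ℝ → ℝ} (hF : Continuous F) :
    Continuous (rint F : HSpace R → ℝ) := by
  refine continuous_iff_seqContinuous.2 fun U V hU => ?_
  obtain ⟨C, hC⟩ := hU.norm.bddAbove_range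
  refine tendsto_rint hF (fun k => hC ⟨k, rfl⟩) fun r hr => ?_
  have := ((evalCLM hr).continuous.tendsto V).comp hU
  simpa only [Function.comp_def, evalCLM_apply] using this

theorem rint_add {R : ℝ} {F G : ℝ → ℝ} {U : HSpace R} (hF : Continuous F) (hG : Continuous G) :
    rint (fun x => F x + G x) U = rint F U + rint G U := by
  rw [rint, rint, rint,
    ← integral_add (integrableOn_radial_comp hF U) (integrableOn_radial_comp hG U)]
  simp only [mul_add]

/-! ### The Nehari manifold and scaling onto it -/

/-- The function `ln (1 + t) - t / (1 + t)`. -/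
def logGap (t : ℝ) : ℝ := Real.log (1 + t) - t / (1 + t)

theorem continuous_logGap_sq {α : ℝ} (hα : 0 < α) : Continuous fun x => logGap (α * x ^ 2) :=
  (continuous_log_sq hα).sub (by
    refine Continuous.div (by fun_prop) (by fun_prop) fun x => by positivity)

theorem saturation_nonneg {α : ℝ} (hα : 0 < α) (x : ℝ) : 0 ≤ x ^ 2 / (1 + α * x ^ 2) := by positivity

/-- Monotonicity is what makes the action on the Nehari manifold decrease under scaling by t ≤ 1. It
follows from ln x ≤ x - 1 at x = (1 + t)/(1 + s). -/
theorem logGap_mono {s t : ℝ} (ht : 0 ≤ t) (hts : t ≤ s) : logGap t ≤ logGap s := by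
  have h1 : 0 < 1 + t := by linarith
  have h2 : 0 < 1 + s := by linarith
  have h3 := Real.log_le_sub_one_of_pos (div_pos h1 h2)
  rw [Real.log_div h1.ne' h2.ne'] at h3
  have e : logGap s - logGap t - (Real.log (1 + s) - Real.log (1 + t) - (1 - (1 + t) / (1 + s)))
      = (s - t) * t / ((1 + s) * (1 + t)) := by
    unfold logGap; field_simp; ring
  have h4 : 0 ≤ (s - t) * t / ((1 + s) * (1 + t)) := by
    have := sub_nonneg.2 hts; positivity
  linarith

theorem logGap_nonneg {t : ℝ} (ht : 0 ≤ t) : 0 ≤ logGap t := by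
  simpa [logGap] using logGap_mono le_rfl ht

theorem log_sub_one_le_logGap {t : ℝ} (ht : 0 ≤ t) : Real.log (1 + t) - 1 ≤ logGap t := by
  have : t / (1 + t) ≤ 1 := by rw [div_le_one (by linarith)]; linarith
  unfold logGap; linarith

section Variational

variable {n : ℤ} {α κ R : ℝ}

/-- Subtracting γ = 0 from the action cancels the quadratic form and the mass, leaving only the
nonlinear terms. -/
theorem action_of_nehari (hα : 0 < α) (hR : 0 < R) {U : HSpace R}
    (hU : nehariFunctional n α κ R U = 0) :
    action n α κ R U = α⁻¹ ^ 2 * rint (fun x => logGap (α * x ^ 2)) U := by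
  have hs := continuous_saturation hα
  have e : rint (fun x => logGap (α * x ^ 2)) U
      = rint (fun x => Real.log (1 + α * x ^ 2)) U
        + -α * rint (fun x => x ^ 2 / (1 + α * x ^ 2)) U := by
    rw [← rint_const_mul, ← rint_add (continuous_log_sq hα) (hs.const_mul _)]
    congr 1; ext x; simp only [logGap]; ring
  rw [nehariFunctional_eq n κ hα hR] at hU
  rw [action_eq n κ hα hR, e]
  have : α⁻¹ ^ 2 * α = α⁻¹ := by field_simp
  linear_combination hU + rint (fun x => x ^ 2 / (1 + α * x ^ 2)) U * this

/-- Here γ(tV) = t² f(t)/2 with f continuous, positive at 0 and nonpositive at 1, so the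
intermediate value theorem applies. The bound t ≤ 1 is needed for the minimisation. -/
theorem exists_smul_mem_nehari (hα : 0 < α) (hR : 0 < R) {V : HSpace R}
    (hpos : 0 < qf n V V + 2 * κ * rint (· ^ 2) V) (hV : nehariFunctional n α κ R V ≤ 0) :
    ∃ t : ℝ, 0 < t ∧ t ≤ 1 ∧ t • V ∈ nehari n α κ R := by
  set f : ℝ → ℝ := fun t => qf n V V - 2 * (α⁻¹ - κ) * rint (· ^ 2) V
    + 2 * α⁻¹ * ∫ r in Ioo 0 R, r * (rep V r ^ 2 / (1 + α * (t * rep V r) ^ 2)) with hf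
  have hfc : Continuous f := by
    refine continuous_const.add (continuous_const.mul ?_)
    refine continuous_of_dominated (bound := fun r => r * rep V r ^ 2) (fun t => ?_) (fun t => ?_)
      (integrableOn_radial_comp (continuous_pow 2) V) ?_
    · exact (integrableOn_radial_comp (F := fun x => x ^ 2 / (1 + α * (t * x) ^ 2))
        ((continuous_pow 2).div (by fun_prop) fun x => by positivity) V).aestronglyMeasurable
    · filter_upwards [ae_restrict_mem measurableSet_Ioo] with r hr
      have h0 := hr.1
      rw [Real.norm_eq_abs, abs_of_nonneg (by positivity)]
      gcongr
      exact div_le_self (sq_nonneg _) (by nlinarith [mul_nonneg hα.le (sq_nonneg (t * rep V r))])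
    · filter_upwards with r
      refine continuous_const.mul (continuous_const.div (by fun_prop) fun t => by positivity)
  have hγ : ∀ t, nehariFunctional n α κ R (t • V) = 1 / 2 * (t ^ 2 * f t) := fun t => by
    have e : rint (fun x => x ^ 2 / (1 + α * x ^ 2)) (t • V)
        = t ^ 2 * ∫ r in Ioo 0 R, r * (rep V r ^ 2 / (1 + α * (t * rep V r) ^ 2)) := by
      rw [rint, ← integral_const_mul]
      refine setIntegral_congr_fun measurableSet_Ioo fun r hr => ?_
      simp only [rep_smul hr]; ring
    rw [nehariFunctional_eq n κ hα hR, e, rint_sq_smul, qf_smul_left, qf_smul_right, hf]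
    ring
  -- At t = 0 the saturation term is 2α⁻¹P, which turns the coefficient -2(α⁻¹ - κ) into 2κ.
  have hf0 : 0 < f 0 := by
    have e : f 0 = qf n V V + 2 * κ * rint (· ^ 2) V := by simp [hf, rint]; ring
    rwa [e]
  have hf1 : f 1 ≤ 0 := by
    have := hγ 1
    rw [one_smul] at this
    linarith
  obtain ⟨t, ht, h0⟩ := intermediate_value_Icc' zero_le_one hfc.continuousOn ⟨hf1, hf0.le⟩
  have ht0 : 0 < t := ht.1.lt_of_ne fun h => by rw [← h] at h0; linarith
  refine ⟨t, ht0, ht.2, fun h => ?_, by rw [hγ, h0]; simp⟩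
  have hV0 : V = 0 := (smul_eq_zero.1 h).resolve_left ht0.ne'
  have e1 : qf n V V = 0 := by rw [hV0]; simp [qf]
  have e2 : rint (· ^ 2) V = 0 := by
    have := rint_sq_smul 0 V
    rw [zero_smul, ← hV0] at this
    simpa using this
  rw [e1, e2] at hpos
  simp at hpos

theorem coercive_pos {lam : ℝ} (hlam : 0 < lam + 2 * κ)
    (hP : ∀ U : HSpace R, lam * rint (· ^ 2) U ≤ qf n U U) {V : HSpace R}
    (hV : 0 < rint (· ^ 2) V) : 0 < qf n V V + 2 * κ * rint (· ^ 2) V := by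
  nlinarith [hP V, mul_pos hlam hV]

/-- For large T the saturation term stays bounded while the quadratic part of γ(TV) tends to -∞, so
γ(TV) ≤ 0 and the previous scaling applies to TV. -/
theorem exists_smul_mem_nehari_of_qf_lt {lam : ℝ} (hα : 0 < α) (hR : 0 < R) (hβ : 0 < α⁻¹ - κ)
    (hlam : 0 < lam + 2 * κ) (hP : ∀ U : HSpace R, lam * rint (· ^ 2) U ≤ qf n U U)
    {V : HSpace R} (hV : qf n V V < 2 * (α⁻¹ - κ) * rint (· ^ 2) V) :
    ∃ t : ℝ, 0 < t ∧ t • V ∈ nehari n α κ R := by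
  set δ := 2 * (α⁻¹ - κ) * rint (· ^ 2) V - qf n V V with hδ
  have hδ0 : 0 < δ := sub_pos.2 hV
  -- Since x²/(1 + αx²) ≤ α⁻¹, the saturation term is at most 2α⁻¹ · α⁻¹R²/2 = R²/α²; T is chosen so
  -- that T²δ equals this bound.
  set T := R / (α * Real.sqrt δ) with hT
  have hT0 : 0 < T := by have := Real.sqrt_pos.2 hδ0; positivity
  have hTδ : T ^ 2 * δ = R ^ 2 / α ^ 2 := by
    rw [hT, div_pow, mul_pow, Real.sq_sqrt hδ0.le]; field_simp
  have hPV : 0 < rint (· ^ 2) V := by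
    have h1 := (qf_self_nonneg n V).trans_lt hV
    exact (pos_iff_pos_of_mul_pos h1).1 (by linarith)
  have hN : rint (fun x => x ^ 2 / (1 + α * x ^ 2)) (T • V) ≤ α⁻¹ * (R ^ 2 / 2) := by
    have h := rint_mono (continuous_saturation hα) (continuous_const (y := α⁻¹)) (T • V) V
      fun r _ => ?_
    · refine h.trans_eq ?_
      rw [rint, ← integral_radial_one hR.le, ← integral_const_mul]
      simp only [mul_comm]
    · rw [div_le_iff₀ (by positivity), mul_add, ← mul_assoc, inv_mul_cancel₀ hα.ne']
      have := inv_pos.2 hα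
      linarith
  have hPT : 0 < rint (· ^ 2) (T • V) := by rw [rint_sq_smul]; positivity
  obtain ⟨t, ht0, -, ht⟩ := exists_smul_mem_nehari hα hR (coercive_pos hlam hP hPT) (by
    rw [nehariFunctional_eq n κ hα hR, rint_sq_smul, qf_smul_left, qf_smul_right]
    have h1 : 2 * α⁻¹ * rint (fun x => x ^ 2 / (1 + α * x ^ 2)) (T • V) ≤ R ^ 2 / α ^ 2 := by
      calc _ ≤ 2 * α⁻¹ * (α⁻¹ * (R ^ 2 / 2)) := by gcongr
        _ = R ^ 2 / α ^ 2 := by field_simp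
    rw [← hTδ, hδ] at h1
    linarith)
  exact ⟨t * T, mul_pos ht0 hT0, by rwa [mul_smul]⟩

/-! ### First variation on the Nehari manifold -/

/-- The weight of the linearised equation at height `x`. -/
def weight (α κ x : ℝ) : ℝ := -2 * (α⁻¹ - κ) + 2 * α⁻¹ / (1 + α * x ^ 2)

theorem continuous_weight (hα : 0 < α) : Continuous (weight α κ) :=
  continuous_const.add (continuous_const.div (by fun_prop) fun x => by positivity)

theorem nehariFunctional_eq_weight (hα : 0 < α) (hR : 0 < R) (U : HSpace R) :
    nehariFunctional n α κ R U = 1 / 2 * (qf n U U + rint (fun x => weight α κ x * x ^ 2) U) := by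
  have e : rint (fun x => weight α κ x * x ^ 2) U = -(2 * (α⁻¹ - κ)) * rint (· ^ 2) U
      + 2 * α⁻¹ * rint (fun x => x ^ 2 / (1 + α * x ^ 2)) U := by
    rw [← rint_const_mul, ← rint_const_mul, ← rint_add ((continuous_pow 2).const_mul _)
      ((continuous_saturation hα).const_mul _)]
    congr 1; ext x; simp only [weight]; ring
  rw [nehariFunctional_eq n κ hα hR, e]; ring

/-- As a function of y² the left side is concave, and `weight α κ x` is its slope at x²; this is the
tangent line inequality. -/
theorem log_concavity (hα : 0 < α) (x y : ℝ) :
    -2 * (α⁻¹ - κ) * y ^ 2 + 2 * α⁻¹ ^ 2 * Real.log (1 + α * y ^ 2)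
      ≤ -2 * (α⁻¹ - κ) * x ^ 2 + 2 * α⁻¹ ^ 2 * Real.log (1 + α * x ^ 2)
        + weight α κ x * (y ^ 2 - x ^ 2) := by
  have h1 : 0 < 1 + α * x ^ 2 := by positivity
  have h2 : 0 < 1 + α * y ^ 2 := by positivity
  have h3 := Real.log_le_sub_one_of_pos (div_pos h2 h1)
  rw [Real.log_div h2.ne' h1.ne'] at h3
  have h4 := mul_le_mul_of_nonneg_left h3 (by positivity : 0 ≤ 2 * α⁻¹ ^ 2)
  have e : 2 * α⁻¹ ^ 2 * ((1 + α * y ^ 2) / (1 + α * x ^ 2) - 1)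
      = 2 * α⁻¹ / (1 + α * x ^ 2) * (y ^ 2 - x ^ 2) := by field_simp; ring
  rw [e] at h4
  unfold weight
  linarith

theorem action_eq_rint (hα : 0 < α) (hR : 0 < R) (U : HSpace R) :
    action n α κ R U = 1 / 2 * (qf n U U + rint (fun x => -2 * (α⁻¹ - κ) * x ^ 2
      + 2 * α⁻¹ ^ 2 * Real.log (1 + α * x ^ 2)) U) := by
  have e : rint (fun x => -2 * (α⁻¹ - κ) * x ^ 2
      + 2 * α⁻¹ ^ 2 * Real.log (1 + α * x ^ 2)) U = -2 * (α⁻¹ - κ) * rint (· ^ 2) U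
      + 2 * α⁻¹ ^ 2 * rint (fun x => Real.log (1 + α * x ^ 2)) U := by
    rw [← rint_const_mul, ← rint_const_mul, ← rint_add ((continuous_pow 2).const_mul _)
      ((continuous_log_sq hα).const_mul _)]
  rw [action_eq n κ hα hR, e]; ring

/-- Integrated tangent inequality at U: the upper bound is homogeneous of degree two in t, apart
from the constant γ(U). -/
theorem action_smul_add_sub_le (hα : 0 < α) (hR : 0 < R) (U Φ : HSpace R) (s t : ℝ) :
    action n α κ R (t • (U + s • Φ)) - action n α κ R U
      ≤ 1 / 2 * (t ^ 2 * (2 * nehariFunctional n α κ R U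
        + 2 * s * (qf n U Φ + ∫ r in Ioo 0 R, r * (weight α κ (rep U r) * rep U r * rep Φ r))
        + s ^ 2 * (qf n Φ Φ + ∫ r in Ioo 0 R, r * (weight α κ (rep U r) * rep Φ r ^ 2)))
        - 2 * nehariFunctional n α κ R U) := by
  have hw := continuous_weight (κ := κ) hα
  have hl := continuous_log_sq hα
  have i0 := integrableOn_radial_comp (F := fun x => weight α κ x * x ^ 2) (by fun_prop) U
  have i1 := integrableOn_radial_comp₂ (F := fun p => weight α κ p.1 * p.1 * p.2) (by fun_prop) U Φ
  have i2 := integrableOn_radial_comp₂ (F := fun p => weight α κ p.1 * p.2 ^ 2) (by fun_prop) U Φ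
  have iH := integrableOn_radial_comp (R := R) (F := fun x => -2 * (α⁻¹ - κ) * x ^ 2
      + 2 * α⁻¹ ^ 2 * Real.log (1 + α * x ^ 2)) (by fun_prop)
  have key : rint (fun x => -2 * (α⁻¹ - κ) * x ^ 2 + 2 * α⁻¹ ^ 2 * Real.log (1 + α * x ^ 2))
      (t • (U + s • Φ)) ≤ rint (fun x => -2 * (α⁻¹ - κ) * x ^ 2
        + 2 * α⁻¹ ^ 2 * Real.log (1 + α * x ^ 2)) U
      + (t ^ 2 - 1) * rint (fun x => weight α κ x * x ^ 2) U
      + (t ^ 2 * (2 * s)) * (∫ r in Ioo 0 R, r * (weight α κ (rep U r) * rep U r * rep Φ r))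
      + (t ^ 2 * s ^ 2) * ∫ r in Ioo 0 R, r * (weight α κ (rep U r) * rep Φ r ^ 2) := by
    simp only [rint]
    rw [← integral_const_mul, ← integral_const_mul, ← integral_const_mul, ← integral_add (iH U),
      ← integral_add, ← integral_add]
    · refine setIntegral_mono_on (iH _) ?_ measurableSet_Ioo fun r hr => ?_
      · exact (((iH U).add (i0.const_mul _)).add (i1.const_mul _)).add (i2.const_mul _)
      · have h := mul_le_mul_of_nonneg_left (log_concavity (κ := κ) hα (rep U r)
          (rep (t • (U + s • Φ)) r)) hr.1.le
        refine h.trans_eq ?_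
        rw [rep_smul hr, rep_add hr, rep_smul hr]
        ring
    · exact ((iH U).add (i0.const_mul _)).add (i1.const_mul _)
    · exact i2.const_mul _
    · exact (iH U).add (i0.const_mul _)
    · exact i1.const_mul _
    · exact i0.const_mul _
  have eq : qf n (t • (U + s • Φ)) (t • (U + s • Φ))
      = t ^ 2 * (qf n U U + 2 * s * qf n U Φ + s ^ 2 * qf n Φ Φ) := by
    simp only [qf_smul_left, qf_smul_right, qf_add_left, qf_add_right, qf_comm n Φ U]; ring
  rw [action_eq_rint hα hR, action_eq_rint hα hR, nehariFunctional_eq_weight hα hR, eq]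
  linarith

/-- The strict inequality q < 2βP is open, so U + sΦ can be scaled onto the manifold for small s.
Minimality and the quadratic upper bound give a nonnegative first variation; replacing Φ by -Φ gives
equality. -/
theorem euler_lagrange {lam : ℝ} (hα : 0 < α) (hR : 0 < R) (hβ : 0 < α⁻¹ - κ)
    (hlam : 0 < lam + 2 * κ) (hP : ∀ U : HSpace R, lam * rint (· ^ 2) U ≤ qf n U U)
    {U : HSpace R} (hU : U ∈ nehari n α κ R)
    (hlt : qf n U U < 2 * (α⁻¹ - κ) * rint (· ^ 2) U)
    (hmin : IsMinOn (action n α κ R) (nehari n α κ R) U) (Φ : HSpace R) :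
    qf n U Φ + ∫ r in Ioo 0 R, r * (weight α κ (rep U r) * rep U r * rep Φ r) = 0 := by
  have nonneg : ∀ Φ : HSpace R,
      0 ≤ qf n U Φ + ∫ r in Ioo 0 R, r * (weight α κ (rep U r) * rep U r * rep Φ r) := by
    intro Φ
    set D := qf n U Φ + ∫ r in Ioo 0 R, r * (weight α κ (rep U r) * rep U r * rep Φ r) with hD
    set C := qf n Φ Φ + ∫ r in Ioo 0 R, r * (weight α κ (rep U r) * rep Φ r ^ 2) with hC
    have hc : Continuous fun s : ℝ => U + s • Φ := by fun_prop
    have hnear : ∀ᶠ s in 𝓝 (0 : ℝ), qf n (U + s • Φ) (U + s • Φ)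
        < 2 * (α⁻¹ - κ) * rint (· ^ 2) (U + s • Φ) := by
      refine ((continuous_qf_self n R).comp hc).continuousAt.eventually_lt
        (((continuous_rint (continuous_pow 2)).comp hc).continuousAt.const_mul _) ?_
      simpa using hlt
    have hle : ∀ᶠ s in 𝓝[>] (0 : ℝ), 0 ≤ 2 * D + s * C := by
      filter_upwards [nhdsWithin_le_nhds hnear, self_mem_nhdsWithin] with s hs hs0
      obtain ⟨t, ht0, ht⟩ := exists_smul_mem_nehari_of_qf_lt hα hR hβ hlam hP hs
      have h1 := action_smul_add_sub_le (n := n) (κ := κ) hα hR U Φ s t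
      have h2 : action n α κ R U ≤ action n α κ R (t • (U + s • Φ)) := hmin ht
      rw [hU.2] at h1
      -- With γ(U) = 0 the scaling t enters only through the positive factor t²s, which is divided
      -- out. Hence neither the size nor the regularity of t matters.
      have h3 : 0 ≤ (t ^ 2 * s) * (2 * D + s * C) := by rw [hD, hC]; linarith
      have hs0' : 0 < s := hs0
      exact nonneg_of_mul_nonneg_right h3 (by positivity)
    have hlim : Tendsto (fun s : ℝ => 2 * D + s * C) (𝓝[>] 0) (𝓝 (2 * D + 0 * C)) :=
      ((by fun_prop : Continuous fun s : ℝ => 2 * D + s * C).tendsto 0).mono_left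
        nhdsWithin_le_nhds
    have := ge_of_tendsto hlim hle
    linarith
  refine le_antisymm ?_ (nonneg Φ)
  have h := nonneg ((-1 : ℝ) • Φ)
  rw [qf_smul_right] at h
  have e : ∫ r in Ioo 0 R, r * (weight α κ (rep U r) * rep U r * rep ((-1 : ℝ) • Φ) r)
      = -1 * ∫ r in Ioo 0 R, r * (weight α κ (rep U r) * rep U r * rep Φ r) := by
    rw [← integral_const_mul]
    refine setIntegral_congr_fun measurableSet_Ioo fun r hr => ?_
    simp only [rep_smul hr]; ring
  rw [e, qf_comm] at h
  rw [qf_comm]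
  linarith

/-! ### A priori bounds and existence of a minimiser -/

theorem rint_sq_pos_of_nehari (hn : 1 ≤ |n|) (hα : 0 < α) (hR : 0 < R) (hβ : 0 < α⁻¹ - κ)
    {U : HSpace R} (hU : U ∈ nehari n α κ R) :
    qf n U U ≤ 2 * (α⁻¹ - κ) * rint (· ^ 2) U ∧ 0 < rint (· ^ 2) U := by
  have h := hU.2
  rw [nehariFunctional_eq n κ hα hR] at h
  have hN : 0 ≤ 2 * α⁻¹ * rint (fun x => x ^ 2 / (1 + α * x ^ 2)) U :=
    mul_nonneg (by positivity) <| setIntegral_nonneg measurableSet_Ioo fun r hr =>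
      mul_nonneg hr.1.le (saturation_nonneg hα _)
  have h1 : qf n U U ≤ 2 * (α⁻¹ - κ) * rint (· ^ 2) U := by linarith
  have h2 : 0 < qf n U U := lt_of_lt_of_le (by have := norm_pos_iff.2 hU.1; positivity)
    (norm_sq_le_qf hn U)
  exact ⟨h1, (pos_iff_pos_of_mul_pos (h2.trans_le h1)).1 (by linarith)⟩

theorem saturation_lower_bound (hα : 0 < α) (U : HSpace R) :
    rint (· ^ 2) U / (1 + α * ‖U‖ ^ 2) ≤ rint (fun x => x ^ 2 / (1 + α * x ^ 2)) U := by
  have h := rint_mono (F := fun x => (1 + α * ‖U‖ ^ 2)⁻¹ * x ^ 2) (by fun_prop)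
    (continuous_saturation hα) U U fun r hr => ?_
  · rwa [rint_const_mul, inv_mul_eq_div] at h
  · rw [inv_mul_eq_div]
    have := sq_le_sq' (abs_le.1 (abs_rep_le hr U)).1 (abs_le.1 (abs_rep_le hr U)).2
    gcongr

theorem qf_lt_of_nehariFunctional_nonpos (hα : 0 < α) (hR : 0 < R) {U : HSpace R}
    (hU : nehariFunctional n α κ R U ≤ 0) (hP : 0 < rint (· ^ 2) U) :
    qf n U U < 2 * (α⁻¹ - κ) * rint (· ^ 2) U := by
  rw [nehariFunctional_eq n κ hα hR] at hU
  have h1 : 0 < rint (fun x => x ^ 2 / (1 + α * x ^ 2)) U :=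
    lt_of_lt_of_le (by positivity) (saturation_lower_bound hα U)
  have h2 : 0 < 2 * α⁻¹ * rint (fun x => x ^ 2 / (1 + α * x ^ 2)) U := by positivity
  linarith

/-- Elements of the Nehari manifold stay away from zero. -/
theorem rint_sq_lower_bound {lam : ℝ} (hn : 1 ≤ |n|) (hα : 0 < α) (hR : 0 < R) (hβ : 0 < α⁻¹ - κ)
    (hP : ∀ U : HSpace R, lam * rint (· ^ 2) U ≤ qf n U U)
    {U : HSpace R} (hU : U ∈ nehari n α κ R) :
    (lam + 2 * κ) / (4 * (α⁻¹ - κ)) ≤ rint (· ^ 2) U := by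
  obtain ⟨h1, h2⟩ := rint_sq_pos_of_nehari hn hα hR hβ hU
  set P := rint (· ^ 2) U with hPdef
  -- Pointwise u² ≤ ‖U‖² ≤ q ≤ 2βP, and 1/(1 + y) ≥ 1 - y. Inserted in γ = 0 this gives λP ≤ -2κP +
  -- 4βP², to be divided by P.
  have h3 : (1 - 2 * α * (α⁻¹ - κ) * P) * P ≤ rint (fun x => x ^ 2 / (1 + α * x ^ 2)) U := by
    rw [hPdef, ← rint_const_mul]
    refine rint_mono (by fun_prop) (continuous_saturation hα) U U fun r hr => ?_
    have h4 : rep U r ^ 2 ≤ 2 * (α⁻¹ - κ) * P :=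
      ((sq_abs _).symm.le.trans (pow_le_pow_left₀ (abs_nonneg _) (abs_rep_le hr U) 2)).trans
        ((norm_sq_le_qf hn U).trans h1)
    rw [← hPdef, le_div_iff₀ (by positivity)]
    have h5 : α * rep U r ^ 2 ≤ 2 * α * (α⁻¹ - κ) * P := by
      calc _ ≤ α * (2 * (α⁻¹ - κ) * P) := by gcongr
        _ = _ := by ring
    have h6 : 0 ≤ α * rep U r ^ 2 := by positivity
    have h7 : (1 - 2 * α * (α⁻¹ - κ) * P) * (1 + α * rep U r ^ 2) ≤ 1 := by nlinarith
    calc (1 - 2 * α * (α⁻¹ - κ) * P) * rep U r ^ 2 * (1 + α * rep U r ^ 2)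
        = rep U r ^ 2 * ((1 - 2 * α * (α⁻¹ - κ) * P) * (1 + α * rep U r ^ 2)) := by ring
      _ ≤ rep U r ^ 2 * 1 := by gcongr
      _ = _ := mul_one _
  have h := hU.2
  rw [nehariFunctional_eq n κ hα hR] at h
  have h8 := mul_le_mul_of_nonneg_left h3 (by positivity : 0 ≤ 2 * α⁻¹)
  have e : 2 * α⁻¹ * ((1 - 2 * α * (α⁻¹ - κ) * P) * P) = 2 * α⁻¹ * P - 4 * (α⁻¹ - κ) * P * P := by
    field_simp; ring
  rw [e] at h8
  have h9 := hP U
  rw [div_le_iff₀ (by positivity)]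
  refine le_of_mul_le_mul_right ?_ h2
  linarith

/-- The action controls the mass `∫ r u²` on the Nehari manifold. -/
theorem log_rint_sq_le (hn : 1 ≤ |n|) (hα : 0 < α) (hR : 0 < R) (hβ : 0 < α⁻¹ - κ)
    {U : HSpace R} (hU : U ∈ nehari n α κ R) :
    Real.log (1 + α * (rint (· ^ 2) U / R ^ 2))
      ≤ 1 + 4 * (α⁻¹ - κ) * rint (fun x => logGap (α * x ^ 2)) U := by
  obtain ⟨h1, h2⟩ := rint_sq_pos_of_nehari hn hα hR hβ hU
  set β := α⁻¹ - κ with hβdef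
  set P := rint (· ^ 2) U with hPdef
  set g := logGap (α * (P / R ^ 2)) with hg
  have hg0 : 0 ≤ g := logGap_nonneg (by positivity)
  -- The integrand is bounded below by (g/2β)(u²/P - 1/R²): this is nonpositive where u² ≤ P/R², and
  -- at most g elsewhere since u² ≤ 2βP. Its radial integral is (g/2β)(1 - 1/2).
  have h3 : g / (4 * β) ≤ rint (fun x => logGap (α * x ^ 2)) U := by
    have h := rint_mono (F := fun x => g / (2 * β) * (x ^ 2 / P - 1 / R ^ 2)) (by fun_prop)
      (continuous_logGap_sq hα) U U fun r hr => ?_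
    · refine le_trans (le_of_eq ?_) h
      rw [rint_const_mul]
      have e : rint (fun x => x ^ 2 / P - 1 / R ^ 2) U = 1 - 1 / 2 := by
        have e1 : (fun r : ℝ => r * (rep U r ^ 2 / P - 1 / R ^ 2))
            = fun r => P⁻¹ * (r * rep U r ^ 2) - (R ^ 2)⁻¹ * r := by ext r; ring
        rw [rint, e1, integral_sub, integral_const_mul, integral_const_mul,
          integral_radial_one hR.le]
        · change P⁻¹ * P - _ = _
          field_simp
        · exact (integrableOn_radial_comp (continuous_pow 2) U).const_mul _
        · have h1 := integrableOn_radial_comp (continuous_const (y := (1 : ℝ))) U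
          simp only [mul_one] at h1
          exact h1.const_mul _
      rw [e]; field_simp; norm_num
    · have h4 : rep U r ^ 2 ≤ 2 * β * P :=
        ((sq_abs _).symm.le.trans (pow_le_pow_left₀ (abs_nonneg _) (abs_rep_le hr U) 2)).trans
          ((norm_sq_le_qf hn U).trans h1)
      rcases le_or_gt (rep U r ^ 2) (P / R ^ 2) with h5 | h5
      · have h6 : rep U r ^ 2 / P - 1 / R ^ 2 ≤ 0 := by
          rw [sub_nonpos, div_le_iff₀ h2]
          calc _ ≤ _ := h5
            _ = _ := by ring
        exact (mul_nonpos_of_nonneg_of_nonpos (by positivity) h6).trans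
          (logGap_nonneg (by positivity))
      · have h6 : rep U r ^ 2 / P - 1 / R ^ 2 ≤ 2 * β := by
          have : rep U r ^ 2 / P ≤ 2 * β := by rwa [div_le_iff₀ h2]
          have : 0 < 1 / R ^ 2 := by positivity
          linarith
        calc g / (2 * β) * (rep U r ^ 2 / P - 1 / R ^ 2) ≤ g / (2 * β) * (2 * β) := by gcongr
          _ = g := by field_simp
          _ ≤ _ := logGap_mono (by positivity) (by gcongr)
  rw [div_le_iff₀ (by positivity)] at h3
  have h4 := log_sub_one_le_logGap (t := α * (P / R ^ 2)) (by positivity)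
  linarith

theorem rint_congr {R : ℝ} {F : ℝ → ℝ} {U V : HSpace R}
    (h : ∀ r ∈ Ioo 0 R, F (rep U r) = F (rep V r)) : rint F U = rint F V :=
  setIntegral_congr_fun measurableSet_Ioo fun r hr => by simp only [h r hr]

theorem action_nonneg_of_nehari (hα : 0 < α) (hR : 0 < R) {U : HSpace R}
    (hU : U ∈ nehari n α κ R) : 0 ≤ action n α κ R U := by
  rw [action_of_nehari hα hR hU.2]
  exact mul_nonneg (by positivity) <| setIntegral_nonneg measurableSet_Ioo fun r hr =>
    mul_nonneg hr.1.le (logGap_nonneg (by positivity))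

/-- The weak limit of a minimising sequence may leave the manifold, but only towards γ ≤ 0. Scaling
back uses t ≤ 1, and on the manifold the action is monotone in |u|, so the infimum is attained. -/
theorem exists_nonneg_minimiser {lam : ℝ} (hn : 1 ≤ |n|) (hα : 0 < α) (hR : 0 < R)
    (hβ : 0 < α⁻¹ - κ) (hlam : 0 < lam + 2 * κ)
    (hP : ∀ U : HSpace R, lam * rint (· ^ 2) U ≤ qf n U U)
    (hne : ∃ V : HSpace R, qf n V V < 2 * (α⁻¹ - κ) * rint (· ^ 2) V) :
    ∃ U ∈ nehari n α κ R, IsMinOn (action n α κ R) (nehari n α κ R) U ∧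
      ∀ r ∈ Ioo 0 R, 0 ≤ rep U r := by
  set β := α⁻¹ - κ with hβdef
  set S := action n α κ R '' nehari n α κ R with hS
  have hSne : S.Nonempty := by
    obtain ⟨V, hV⟩ := hne
    obtain ⟨t, -, ht⟩ := exists_smul_mem_nehari_of_qf_lt hα hR hβ hlam hP hV
    exact ⟨_, _, ht, rfl⟩
  have hSb : BddBelow S := ⟨0, by rintro _ ⟨U, hU, rfl⟩; exact action_nonneg_of_nehari hα hR hU⟩
  obtain ⟨a, -, ha, haS⟩ := exists_seq_tendsto_sInf hSne hSb
  choose U hU haU using haS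
  obtain ⟨C, hC⟩ := ha.bddAbove_range
  have hgap : ∀ k, rint (fun x => logGap (α * x ^ 2)) (U k) = α ^ 2 * a k := fun k => by
    rw [← haU k, action_of_nehari hα hR (hU k).2]; field_simp
  have hPb : ∀ k, rint (· ^ 2) (U k) ≤ R ^ 2 / α * Real.exp (1 + 4 * β * (α ^ 2 * C)) := fun k => by
    have h1 := log_rint_sq_le hn hα hR hβ (hU k)
    have h0 := rint_sq_nonneg (U k)
    rw [hgap] at h1
    have h2 : 1 + 4 * β * (α ^ 2 * a k) ≤ 1 + 4 * β * (α ^ 2 * C) := by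
      gcongr; exact hC ⟨k, rfl⟩
    have h3 := (Real.log_le_iff_le_exp (by positivity)).1 (h1.trans h2)
    have e : rint (· ^ 2) (U k) = R ^ 2 / α * (α * (rint (· ^ 2) (U k) / R ^ 2)) := by
      field_simp
    rw [e]
    gcongr
    linarith
  have hb : ∀ k, ‖U k‖ ≤ Real.sqrt (2 * β * (R ^ 2 / α * Real.exp (1 + 4 * β * (α ^ 2 * C)))) :=
    fun k => Real.le_sqrt_of_sq_le <| (norm_sq_le_qf hn _).trans <|
      (rint_sq_pos_of_nehari hn hα hR hβ (hU k)).1.trans (by gcongr; exact hPb k)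
  obtain ⟨W, σ, hσ, hW⟩ := exists_weak_subseq_H hb
  have hlimF : ∀ F : ℝ → ℝ, Continuous F →
      Tendsto (fun k => rint F (U (σ k))) atTop (𝓝 (rint F W)) := fun F hF =>
    tendsto_rint hF (fun k => hb (σ k)) (tendsto_rep_of_weak hW)
  have hlimP := hlimF _ (continuous_pow 2)
  have hlimN := hlimF _ (continuous_saturation hα)
  have hlimG := hlimF _ (continuous_logGap_sq hα)
  have hWpos : 0 < rint (· ^ 2) W := by
    refine lt_of_lt_of_le (b := (lam + 2 * κ) / (4 * β)) (by positivity) ?_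
    exact ge_of_tendsto' hlimP fun k => rint_sq_lower_bound hn hα hR hβ hP (hU (σ k))
  have hWq : qf n W W ≤ 2 * β * rint (· ^ 2) W
      - 2 * α⁻¹ * rint (fun x => x ^ 2 / (1 + α * x ^ 2)) W := by
    refine qf_le_of_tendsto n hW (fun k => ?_) ((hlimP.const_mul _).sub (hlimN.const_mul _))
    have := (hU (σ k)).2
    rw [nehariFunctional_eq n κ hα hR] at this
    linarith
  obtain ⟨V, hV, hVq⟩ := exists_abs hn W
  -- All the nonlinearities are functions of u², hence blind to the passage to |u|; only q changes,
  -- and it does not increase.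
  have hVF : ∀ F : ℝ → ℝ, rint (fun x => F (x ^ 2)) V = rint (fun x => F (x ^ 2)) W := fun F =>
    rint_congr fun r hr => by rw [hV r hr, sq_abs]
  have hVP : rint (· ^ 2) V = rint (· ^ 2) W := hVF id
  have hVN : rint (fun x => x ^ 2 / (1 + α * x ^ 2)) V
      = rint (fun x => x ^ 2 / (1 + α * x ^ 2)) W := hVF fun y => y / (1 + α * y)
  have hVG : rint (fun x => logGap (α * x ^ 2)) V = rint (fun x => logGap (α * x ^ 2)) W :=
    hVF fun y => logGap (α * y)
  obtain ⟨t, ht0, ht1, ht⟩ := exists_smul_mem_nehari hα hR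
    (coercive_pos hlam hP (V := V) (by rwa [hVP])) (by
      rw [nehariFunctional_eq n κ hα hR, hVP, hVN]; linarith)
  refine ⟨t • V, ht, fun Y hY => ?_, fun r hr => ?_⟩
  · have h1 : action n α κ R (t • V) ≤ α⁻¹ ^ 2 * rint (fun x => logGap (α * x ^ 2)) W := by
      rw [action_of_nehari hα hR ht.2, ← hVG]
      gcongr
      refine rint_mono (continuous_logGap_sq hα) (continuous_logGap_sq hα) _ _ fun r hr => ?_
      refine logGap_mono (by positivity) ?_
      rw [rep_smul hr, mul_pow]
      gcongr
      exact mul_le_of_le_one_left (sq_nonneg _) (pow_le_one₀ ht0.le ht1)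
    have h2 : α⁻¹ ^ 2 * rint (fun x => logGap (α * x ^ 2)) W = sInf S := by
      refine tendsto_nhds_unique (hlimG.const_mul _) ((ha.comp hσ.tendsto_atTop).congr fun k => ?_)
      rw [hgap, Function.comp_apply]; field_simp
    exact (h1.trans_eq h2).trans (csInf_le hSb ⟨Y, hY, rfl⟩)
  · rw [rep_smul hr, hV r hr]; positivity

end Variational

/-! ### The Bessel function J₀ and its differential equation -/

theorem hasDerivAt_tsum_pow {c : ℕ → ℝ} (hc : ∀ m, |c m| ≤ 1 / (m.factorial : ℝ)) (y : ℝ) :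
    HasDerivAt (fun z => ∑' m, c m * z ^ m) (∑' m, c m * (m * y ^ (m - 1))) y := by
  set B := |y| + 1 with hB
  have hB0 : 0 ≤ B := by positivity
  have hu : Summable fun m : ℕ => 1 / (m.factorial : ℝ) * (m * B ^ (m - 1)) := by
    rw [← summable_nat_add_iff 1]
    refine (Real.summable_pow_div_factorial B).congr fun m => ?_
    rw [Nat.factorial_succ]
    push_cast
    field_simp
  refine hasDerivAt_tsum_of_isPreconnected hu (Metric.isOpen_ball (x := (0 : ℝ)) (ε := B))
    (convex_ball _ _).isPreconnected (g := fun m z => c m * z ^ m)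
    (g' := fun m z => c m * (m * z ^ (m - 1))) (y₀ := 0)
    (fun m z _ => (hasDerivAt_pow m z).const_mul _) (fun m z hz => ?_) ?_ ?_ ?_
  · rw [mem_ball_zero_iff, Real.norm_eq_abs] at hz
    rw [norm_mul, Real.norm_eq_abs, norm_mul, norm_pow, Real.norm_eq_abs, Real.norm_eq_abs,
      Nat.abs_cast]
    gcongr
    exact hc m
  · simp; positivity
  · refine summable_of_ne_finset_zero (s := {0}) fun m hm => ?_
    simp [Finset.notMem_singleton.1 hm]
  · rw [mem_ball_zero_iff, Real.norm_eq_abs, hB]; linarith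

/-- The coefficients of `J₀` in the variable `x² / 4`. -/
def besselCoeff (m : ℕ) : ℝ := (-1 : ℝ) ^ m / ((m.factorial : ℝ) ^ 2)

theorem abs_besselCoeff (m : ℕ) : |besselCoeff m| = 1 / (m.factorial : ℝ) ^ 2 := by
  simp [besselCoeff, abs_div]

theorem abs_nat_mul_besselCoeff_le (m : ℕ) : |m * besselCoeff m| ≤ 1 / (m.factorial : ℝ) := by
  rw [abs_mul, abs_besselCoeff, Nat.abs_cast, sq, mul_one_div,
    div_le_div_iff₀ (by positivity) (by positivity)]
  have : (m : ℝ) ≤ m.factorial := by exact_mod_cast Nat.self_le_factorial m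
  have h0 : (0 : ℝ) < m.factorial := by positivity
  nlinarith

theorem abs_besselCoeff_le (m : ℕ) : |besselCoeff m| ≤ 1 / (m.factorial : ℝ) := by
  rw [abs_besselCoeff]
  have : (1 : ℝ) ≤ m.factorial := by exact_mod_cast Nat.one_le_iff_ne_zero.2 m.factorial_ne_zero
  gcongr
  nlinarith

theorem besselJ0_eq (x : ℝ) : besselJ0 x = ∑' m, besselCoeff m * ((x / 2) ^ 2) ^ m := by
  simp only [besselJ0, besselCoeff, pow_mul]

/-- The function `x J₀'(x)`. -/
def besselFlux (x : ℝ) : ℝ := 2 * ∑' m : ℕ, m * besselCoeff m * ((x / 2) ^ 2) ^ m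

theorem hasDerivAt_besselJ0 {x : ℝ} (hx : x ≠ 0) : HasDerivAt besselJ0 (besselFlux x / x) x := by
  have h1 : HasDerivAt (fun x : ℝ => (x / 2) ^ 2) (x / 2) x := by
    convert! ((hasDerivAt_id x).div_const 2).pow 2 using 1
    simp; ring
  have h2 := (hasDerivAt_tsum_pow abs_besselCoeff_le ((x / 2) ^ 2)).comp x h1
  rw [funext besselJ0_eq]
  refine h2.congr_deriv ?_
  have e : x / 2 * x = 2 * (x / 2) ^ 2 := by ring
  rw [besselFlux, eq_div_iff hx, mul_assoc, e, mul_left_comm, ← tsum_mul_right]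
  congr 1
  refine tsum_congr fun m => ?_
  rcases m with _ | m
  · simp
  · rw [Nat.add_sub_cancel, pow_succ]; ring

/-- This is Bessel's equation (x J₀')' = -x J₀. Working with x J₀' keeps it free of division at 0.
-/
theorem hasDerivAt_besselFlux (x : ℝ) : HasDerivAt besselFlux (-x * besselJ0 x) x := by
  have h1 : HasDerivAt (fun x : ℝ => (x / 2) ^ 2) (x / 2) x := by
    convert! ((hasDerivAt_id x).div_const 2).pow 2 using 1
    simp; ring
  have h0 := hasDerivAt_tsum_pow abs_nat_mul_besselCoeff_le ((x / 2) ^ 2)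
  have h2 := (h0.comp x h1).const_mul 2
  refine h2.congr_deriv ?_
  have e : ∑' m : ℕ, (m * besselCoeff m * (m * ((x / 2) ^ 2) ^ (m - 1))) = -besselJ0 x := by
    -- The recursion (m + 1)² c_{m+1} = -c_m for the coefficients.
    have hs : ∀ m : ℕ, ((m + 1 : ℕ) * besselCoeff (m + 1) * ((m + 1 : ℕ) *
        ((x / 2) ^ 2) ^ (m + 1 - 1))) = -(besselCoeff m * ((x / 2) ^ 2) ^ m) := fun m => by
      rw [Nat.add_sub_cancel, besselCoeff, besselCoeff, Nat.factorial_succ, pow_succ]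
      push_cast
      field_simp
    have hsum : Summable fun m : ℕ => besselCoeff m * ((x / 2) ^ 2) ^ m := by
      refine Summable.of_norm_bounded (Real.summable_pow_div_factorial ((x / 2) ^ 2)) fun m => ?_
      have h0 : 0 ≤ ((x / 2) ^ 2) ^ m := by positivity
      rw [norm_mul, Real.norm_eq_abs, Real.norm_eq_abs, abs_of_nonneg h0]
      have h1 := mul_le_mul_of_nonneg_left (abs_besselCoeff_le m) h0
      rwa [mul_one_div, mul_comm] at h1
    rw [Summable.tsum_eq_zero_add]
    · simp only [hs, tsum_neg, besselJ0_eq]; simp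
    · rw [← summable_nat_add_iff 1]
      simp only [hs]
      exact hsum.neg
  rw [e]; ring

theorem continuous_besselJ0 : Continuous besselJ0 := by
  rw [funext besselJ0_eq]
  have h : Continuous fun z : ℝ => ∑' m, besselCoeff m * z ^ m :=
    continuous_iff_continuousAt.2 fun y => (hasDerivAt_tsum_pow abs_besselCoeff_le y).continuousAt
  exact h.comp (by fun_prop)

theorem continuous_besselFlux : Continuous besselFlux :=
  continuous_iff_continuousAt.2 fun x => (hasDerivAt_besselFlux x).continuousAt

theorem besselJ0_zero : besselJ0 0 = 1 := by
  rw [besselJ0, tsum_eq_single 0]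
  · simp
  · intro m hm; simp [hm]

theorem besselJ0_pos {r₀ x : ℝ} (hr₀ : IsLeast {x : ℝ | 0 < x ∧ besselJ0 x = 0} r₀)
    (hx : 0 ≤ x) (hxr : x < r₀) : 0 < besselJ0 x := by
  by_contra! h
  obtain ⟨y, hy, hy0⟩ := intermediate_value_Icc' hx continuous_besselJ0.continuousOn
    ⟨h, by rw [besselJ0_zero]; exact zero_le_one⟩
  have hy' : 0 < y := hy.1.lt_of_ne fun h => by
    rw [← h, besselJ0_zero] at hy0; exact one_ne_zero hy0
  linarith [hr₀.2 ⟨hy', hy0⟩, hy.2]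

/-! ### Picone's identity and the Poincaré inequality -/

theorem integrableOn_test_sq {R : ℝ} (φ : testSpace R) :
    IntegrableOn (fun r => r * (φ : ℝ → ℝ) r ^ 2) (Ioo 0 R) :=
  (integrableOn_radial_comp (continuous_pow 2) (ofTest φ)).congr_fun
    (fun r hr => by simp only [rep_ofTest hr]) measurableSet_Ioo

theorem integrableOn_test_deriv_sq {R : ℝ} (φ : testSpace R) :
    IntegrableOn (fun r => r * deriv (φ : ℝ → ℝ) r ^ 2) (Ioo 0 R) :=
  (integrableOn_hDer_sq (ofTest φ)).congr (by
    filter_upwards [hDer_ofTest φ] with r hr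
    rw [hr])

/-- Picone's inequality against `J₀(k r)` on an interval where that function is positive. -/
theorem picone_bessel {R k : ℝ} (hR : 0 < R) (hk : 0 < k)
    (hpos : ∀ r ∈ Icc 0 R, 0 < besselJ0 (k * r)) (φ : testSpace R) :
    k ^ 2 * ∫ r in Ioo 0 R, r * (φ : ℝ → ℝ) r ^ 2 ≤
      ∫ r in Ioo 0 R, r * deriv (φ : ℝ → ℝ) r ^ 2 := by
  have i1 := integrableOn_test_deriv_sq φ
  have i2 := (integrableOn_test_sq φ).const_mul (k ^ 2)
  rw [← sub_nonneg, ← integral_const_mul, ← integral_sub i1 i2, ← integral_Ioc_eq_integral_Ioo,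
    ← intervalIntegral.integral_of_le hR.le]
  -- With w = J₀(kr), the function g is r w' φ²/w, which vanishes at both ends. The inequality form
  -- of the fundamental theorem needs no integrability of g'.
  have h := intervalIntegral.sub_le_integral_of_hasDeriv_right_of_le
    (g := fun r => besselFlux (k * r) * (φ : ℝ → ℝ) r ^ 2 / besselJ0 (k * r))
    (g' := fun r => ((-(k * r) * besselJ0 (k * r) * k) * (φ : ℝ → ℝ) r ^ 2
      + besselFlux (k * r) * (2 * (φ : ℝ → ℝ) r * deriv (φ : ℝ → ℝ) r)) / besselJ0 (k * r)
      - besselFlux (k * r) * (φ : ℝ → ℝ) r ^ 2 * (besselFlux (k * r) / (k * r) * k)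
        / besselJ0 (k * r) ^ 2)
    (φ := fun r => r * deriv (φ : ℝ → ℝ) r ^ 2 - k ^ 2 * (r * (φ : ℝ → ℝ) r ^ 2))
    hR.le ?_ (fun r hr => ?_) ?_ (fun r hr => ?_)
  · simpa [φ.2.2.1, φ.2.2.2] using h
  · refine ContinuousOn.div (ContinuousOn.mul ?_ (φ.2.1.continuousOn.pow 2)) ?_
      fun r hr => (hpos r hr).ne'
    · exact (continuous_besselFlux.comp (by fun_prop)).continuousOn
    · exact (continuous_besselJ0.comp (by fun_prop)).continuousOn
  · have hkr : HasDerivAt (fun r => k * r) k r := by simpa using (hasDerivAt_id r).const_mul k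
    have hne : k * r ≠ 0 := (mul_pos hk hr.1).ne'
    have hw := (hpos r (Ioo_subset_Icc_self hr)).ne'
    have d1 := (hasDerivAt_besselFlux (k * r)).comp r hkr
    have d2 := (hasDerivAt_besselJ0 hne).comp r hkr
    have d3 := (testSpace_hasDerivAt φ hr).pow 2
    refine HasDerivAt.hasDerivWithinAt (((d1.mul d3).div d2 hw).congr_deriv ?_)
    simp only [Function.comp_apply, Pi.mul_apply, Pi.pow_apply]
    field_simp
    norm_num
    ring
  · exact (integrableOn_Icc_iff_integrableOn_Ioo).2 (i1.sub i2)
  · have hw := hpos r (Ioo_subset_Icc_self hr)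
    have hr0 := hr.1
    rw [← sub_nonneg]
    generalize besselJ0 (k * r) = w at hw ⊢
    generalize besselFlux (k * r) = p
    -- Picone's identity: the defect is r(φ' - φw'/w)².
    have e : r * deriv (φ : ℝ → ℝ) r ^ 2 - k ^ 2 * (r * (φ : ℝ → ℝ) r ^ 2)
      - (((-(k * r) * w * k) * (φ : ℝ → ℝ) r ^ 2
      + p * (2 * (φ : ℝ → ℝ) r * deriv (φ : ℝ → ℝ) r)) / w
      - p * (φ : ℝ → ℝ) r ^ 2 * (p / (k * r) * k)
        / w ^ 2)
      = r * (deriv (φ : ℝ → ℝ) r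
        - (φ : ℝ → ℝ) r * p / (r * w)) ^ 2 := by
      field_simp; ring
    rw [e]
    positivity

/-- J₀(r₀ r/R) vanishes at r = R, so Picone's inequality is used with r₀/S for S > R, where the
comparison function is positive on [0, R]; then S → R. -/
theorem poincare_test {R r₀ : ℝ} (hR : 0 < R)
    (hr₀ : IsLeast {x : ℝ | 0 < x ∧ besselJ0 x = 0} r₀) (φ : testSpace R) :
    (r₀ / R) ^ 2 * ∫ r in Ioo 0 R, r * (φ : ℝ → ℝ) r ^ 2 ≤
      ∫ r in Ioo 0 R, r * deriv (φ : ℝ → ℝ) r ^ 2 := by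
  have hlim : Tendsto (fun S : ℝ => (r₀ / S) ^ 2 * ∫ r in Ioo 0 R, r * (φ : ℝ → ℝ) r ^ 2) (𝓝[>] R)
      (𝓝 ((r₀ / R) ^ 2 * ∫ r in Ioo 0 R, r * (φ : ℝ → ℝ) r ^ 2)) := by
    refine Tendsto.mono_left ?_ nhdsWithin_le_nhds
    exact ((tendsto_const_nhds.div tendsto_id hR.ne').pow 2).mul_const _
  refine le_of_tendsto hlim ?_
  filter_upwards [self_mem_nhdsWithin] with S hS
  have hRS : R < S := hS
  have hS0 : 0 < S := hR.trans hRS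
  have hr₀pos := hr₀.1.1
  refine picone_bessel hR (by positivity) (fun r hr => ?_) φ
  have hr0 := hr.1
  refine besselJ0_pos hr₀ (by positivity) ?_
  rw [div_mul_eq_mul_div, div_lt_iff₀ hS0]
  exact mul_lt_mul_of_pos_left (hr.2.trans_lt hRS) hr₀pos

theorem qf_ofTest (n : ℤ) {R : ℝ} (φ : testSpace R) :
    qf n (ofTest φ) (ofTest φ) = (∫ r in Ioo 0 R, r * deriv (φ : ℝ → ℝ) r ^ 2)
      + (n : ℝ) ^ 2 * ∫ r in Ioo 0 R, r⁻¹ * (φ : ℝ → ℝ) r ^ 2 := by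
  rw [qf_self, normSq_fst, normSq_snd]
  congr 1
  · exact integral_congr_ae (by filter_upwards [hDer_ofTest φ] with r hr; rw [hr])
  · congr 1
    exact integral_congr_ae (by filter_upwards [hVal_ofTest φ] with r hr; rw [hr])

theorem rint_ofTest {R : ℝ} (F : ℝ → ℝ) (φ : testSpace R) :
    rint F (ofTest φ) = ∫ r in Ioo 0 R, r * F ((φ : ℝ → ℝ) r) :=
  setIntegral_congr_fun measurableSet_Ioo fun r hr => by simp only [rep_ofTest hr]

/-- The Poincaré inequality on `H`. -/
theorem poincare (n : ℤ) {R r₀ : ℝ} (hR : 0 < R)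
    (hr₀ : IsLeast {x : ℝ | 0 < x ∧ besselJ0 x = 0} r₀) (U : HSpace R) :
    ((n : ℝ) ^ 2 + r₀ ^ 2) / R ^ 2 * rint (· ^ 2) U ≤ qf n U U := by
  obtain ⟨φ, hφ⟩ := exists_seq_ofTest U
  refine le_of_tendsto_of_tendsto'
    ((((continuous_rint (continuous_pow 2)).tendsto U).comp hφ).const_mul _)
    (((continuous_qf_self n R).tendsto U).comp hφ) fun k => ?_
  simp only [Function.comp_apply]
  rw [qf_ofTest, rint_ofTest]
  have h1 := poincare_test hR hr₀ (φ k)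
  have h2 : (∫ r in Ioo 0 R, r * (φ k : ℝ → ℝ) r ^ 2) / R ^ 2
      ≤ ∫ r in Ioo 0 R, r⁻¹ * (φ k : ℝ → ℝ) r ^ 2 := by
    rw [← integral_div]
    refine setIntegral_mono_on ((integrableOn_test_sq (φ k)).div_const _) ?_ measurableSet_Ioo
      fun r hr => ?_
    · exact (integrableOn_hVal_sq (ofTest (φ k))).congr (by
        filter_upwards [hVal_ofTest (φ k)] with r hr
        rw [hr])
    · have hr0 := hr.1
      rw [mul_comm r, mul_comm r⁻¹, mul_div_assoc]
      gcongr
      rw [div_le_iff₀ (by positivity), inv_mul_eq_div, le_div_iff₀ hr0]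
      nlinarith [hr.2]
  have h3 := mul_le_mul_of_nonneg_left h2 (sq_nonneg (n : ℝ))
  calc _ = (r₀ / R) ^ 2 * (∫ r in Ioo 0 R, r * (φ k : ℝ → ℝ) r ^ 2)
        + (n : ℝ) ^ 2 * ((∫ r in Ioo 0 R, r * (φ k : ℝ → ℝ) r ^ 2) / R ^ 2) := by
        field_simp; ring
    _ ≤ _ := add_le_add h1 h3

/-! ### Explicit test functions -/

theorem integral_trinomial {R : ℝ} (hR : 0 ≤ R) (a b c : ℝ) (m : ℕ) :
    ∫ x in Ioo 0 R, (a * x ^ m + b * x ^ (m + 1) + c * x ^ (m + 2))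
      = a * R ^ (m + 1) / (m + 1) + b * R ^ (m + 2) / (m + 2) + c * R ^ (m + 3) / (m + 3) := by
  rw [← integral_Ioc_eq_integral_Ioo, ← intervalIntegral.integral_of_le hR,
    intervalIntegral.integral_add, intervalIntegral.integral_add]
  · simp only [intervalIntegral.integral_const_mul, integral_pow]
    push_cast
    simp only [ne_eq, Nat.add_eq_zero_iff, one_ne_zero, and_false, not_false_eq_true, zero_pow,
      sub_zero]
    have e1 : (m : ℝ) + 1 + 1 = m + 2 := by ring
    have e2 : (m : ℝ) + 2 + 1 = m + 3 := by ring
    rw [e1, e2]; ring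
  all_goals exact Continuous.intervalIntegrable (by fun_prop) _ _

/-- The function `r ^ (m + 1) (R - r)` of `X`. -/
def bump (R : ℝ) (m : ℕ) : testSpace R :=
  ⟨fun r => r ^ (m + 1) * (R - r), by fun_prop, by simp, by simp⟩

theorem bump_apply (R : ℝ) (m : ℕ) (r : ℝ) : (bump R m : ℝ → ℝ) r = r ^ (m + 1) * (R - r) := rfl

theorem deriv_bump (R : ℝ) (m : ℕ) (r : ℝ) :
    deriv (bump R m : ℝ → ℝ) r = (m + 1) * r ^ m * (R - r) - r ^ (m + 1) := by
  have h : HasDerivAt (bump R m : ℝ → ℝ) _ r :=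
    (hasDerivAt_pow (m + 1) r).mul ((hasDerivAt_id r).const_sub R)
  rw [h.deriv]; simp; ring

theorem qf_bump_zero (n : ℤ) {R : ℝ} (hR : 0 ≤ R) :
    qf n (ofTest (bump R 0)) (ofTest (bump R 0)) = R ^ 4 * (1 / 6 + (n : ℝ) ^ 2 / 12) := by
  rw [qf_ofTest, setIntegral_congr_fun (g := fun r : ℝ => R ^ 2 * r ^ 1 + -(4 * R) * r ^ (1 + 1)
    + 4 * r ^ (1 + 2)) measurableSet_Ioo, integral_trinomial hR,
    setIntegral_congr_fun (s := Ioo 0 R) (g := fun r : ℝ => R ^ 2 * r ^ 1 + -(2 * R) * r ^ (1 + 1)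
    + 1 * r ^ (1 + 2)) measurableSet_Ioo, integral_trinomial hR]
  · norm_num; ring
  · intro r hr
    have := hr.1.ne'
    simp only [bump_apply]; field_simp; ring
  · intro r hr
    simp only [deriv_bump]; norm_num; ring

theorem rint_bump_zero {R : ℝ} (hR : 0 ≤ R) :
    rint (· ^ 2) (ofTest (bump R 0)) = R ^ 6 / 60 := by
  rw [rint_ofTest, setIntegral_congr_fun (g := fun r : ℝ => R ^ 2 * r ^ 3 + -(2 * R) * r ^ (3 + 1)
    + 1 * r ^ (3 + 2)) measurableSet_Ioo, integral_trinomial hR]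
  · norm_num; ring
  · intro r hr
    simp only [bump_apply]; ring

theorem qf_bump_one (n : ℤ) {R : ℝ} (hR : 0 ≤ R) :
    qf n (ofTest (bump R 1)) (ofTest (bump R 1)) = R ^ 6 * (1 / 10 + (n : ℝ) ^ 2 / 60) := by
  rw [qf_ofTest, setIntegral_congr_fun (g := fun r : ℝ => 4 * R ^ 2 * r ^ 3
    + -(12 * R) * r ^ (3 + 1) + 9 * r ^ (3 + 2)) measurableSet_Ioo, integral_trinomial hR,
    setIntegral_congr_fun (s := Ioo 0 R) (g := fun r : ℝ => R ^ 2 * r ^ 3 + -(2 * R) * r ^ (3 + 1)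
    + 1 * r ^ (3 + 2)) measurableSet_Ioo, integral_trinomial hR]
  · norm_num; ring
  · intro r hr
    have := hr.1.ne'
    simp only [bump_apply]; field_simp; ring
  · intro r hr
    simp only [deriv_bump]; norm_num; ring

theorem rint_bump_one {R : ℝ} (hR : 0 ≤ R) :
    rint (· ^ 2) (ofTest (bump R 1)) = R ^ 8 / 168 := by
  rw [rint_ofTest, setIntegral_congr_fun (g := fun r : ℝ => R ^ 2 * r ^ 5 + -(2 * R) * r ^ (5 + 1)
    + 1 * r ^ (5 + 2)) measurableSet_Ioo, integral_trinomial hR]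
  · norm_num; ring
  · intro r hr
    simp only [bump_apply]; ring

/-- The hypothesis gives R²β > 6 + 2.316 n². The profile r(R - r) needs R²β > 5 + 2.5 n², which
suffices for |n| = 1 but not for large n; r²(R - r) needs R²β > 8.4 + 1.4 n², which suffices once n²
≥ 4. -/
theorem exists_qf_lt {n : ℤ} (hn : 1 ≤ |n|) {R β : ℝ} (hR : 0 < R) (hβ : 0 < β)
    (h : Real.sqrt (6 * (1 + (n : ℝ) ^ 2 * (2 * Real.log 2 - 1)) / β) < R) :
    ∃ V : HSpace R, qf n V V < 2 * β * rint (· ^ 2) V := by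
  rw [Real.sqrt_lt' hR, div_lt_iff₀ hβ] at h
  have hlog : 0.386 ≤ 2 * Real.log 2 - 1 := by linarith [Real.log_two_gt_d9]
  have h' : 6 * (1 + (n : ℝ) ^ 2 * 0.386) < R ^ 2 * β := lt_of_le_of_lt (by gcongr) h
  rcases hn.eq_or_lt with h1 | h2
  · have hn2 : (n : ℝ) ^ 2 = 1 := by
      rw [← sq_abs]; exact_mod_cast (by rw [← h1]; rfl : |n| ^ 2 = 1)
    refine ⟨ofTest (bump R 0), ?_⟩
    rw [qf_bump_zero n hR.le, rint_bump_zero hR.le]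
    rw [hn2] at h' ⊢
    have := mul_lt_mul_of_pos_left h' (by positivity : 0 < R ^ 4 / 30)
    have h4 : 0 < R ^ 4 := by positivity
    linarith
  · have hn2 : (4 : ℝ) ≤ (n : ℝ) ^ 2 := by
      rw [← sq_abs]
      have h3 : (2 : ℤ) ≤ |n| := h2
      exact_mod_cast (by nlinarith : (4 : ℤ) ≤ |n| ^ 2)
    refine ⟨ofTest (bump R 1), ?_⟩
    rw [qf_bump_one n hR.le, rint_bump_one hR.le]
    have h3 : 84 * (1 / 10 + (n : ℝ) ^ 2 / 60) < R ^ 2 * β := by linarith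
    have := mul_lt_mul_of_pos_left h3 (by positivity : 0 < R ^ 6 / 84)
    linarith

/-! ### Regularity of weak solutions -/

theorem integrable_mul_of_tsupport_subset {s : Set ℝ} {g θ : ℝ → ℝ} (hg : LocallyIntegrableOn g s)
    (hθ : Continuous θ) (hc : HasCompactSupport θ) (hs : tsupport θ ⊆ s) :
    Integrable fun x => θ x * g x := by
  have h1 : IntegrableOn (fun x => θ x * g x) (tsupport θ) :=
    (hg.integrableOn_compact_subset hs hc).continuousOn_mul hθ.continuousOn hc
  refine (integrableOn_iff_integrable_of_support_subset fun x hx => ?_).1 h1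
  exact subset_tsupport θ fun h => hx (by simp [h])

/-- **Du Bois-Reymond lemma** on an open interval. -/
theorem ae_eq_const_of_integral_mul_eq_zero {a b : ℝ} (hab : a < b) {g : ℝ → ℝ}
    (hg : LocallyIntegrableOn g (Ioo a b))
    (h : ∀ θ : ℝ → ℝ, ContDiff ℝ ∞ θ → HasCompactSupport θ → tsupport θ ⊆ Ioo a b →
      ∫ x, θ x = 0 → ∫ x, θ x * g x = 0) :
    ∃ c, ∀ᵐ x, x ∈ Ioo a b → g x = c := by
  let ψ : ContDiffBump ((a + b) / 2) :=
    ⟨(b - a) / 8, (b - a) / 4, by linarith, by linarith⟩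
  have hψs : tsupport (ψ.normed volume) ⊆ Ioo a b := by
    rw [ψ.tsupport_normed_eq, Real.closedBall_eq_Icc]
    refine Icc_subset_Ioo ?_ ?_ <;> simp only [ψ] <;> linarith
  have hψc : Continuous (ψ.normed volume) := ψ.continuous_normed
  have hψi := integrable_mul_of_tsupport_subset hg hψc ψ.hasCompactSupport_normed hψs
  refine ⟨∫ x, ψ.normed volume x * g x, ?_⟩
  set c := ∫ x, ψ.normed volume x * g x with hc
  have key := isOpen_Ioo.ae_eq_zero_of_integral_contDiff_smul_eq_zero (μ := volume)
    (U := Ioo a b) (f := fun x => g x - c) (hg.sub ((locallyIntegrable_const c).locallyIntegrableOn _))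
    fun η hη hηc hηs => ?_
  · filter_upwards [key] with x hx hx'
    exact sub_eq_zero.1 (hx hx')
  · have hηi := integrable_mul_of_tsupport_subset hg hη.continuous hηc hηs
    have hηi' : Integrable η := hη.continuous.integrable_of_hasCompactSupport hηc
    have hψi' : Integrable (ψ.normed volume) := ψ.integrable_normed
    set m := ∫ x, η x with hm
    -- Subtracting a multiple of a bump of integral one gives mean zero, so the hypothesis applies
    -- to θ; the constant is the average of g against that bump.
    set θ : ℝ → ℝ := fun x => η x - m * ψ.normed volume x with hθ
    have hsub : tsupport θ ⊆ tsupport η ∪ tsupport (ψ.normed volume) := by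
      refine closure_minimal (fun x hx => ?_) ((isClosed_tsupport _).union (isClosed_tsupport _))
      by_contra hcon
      rw [mem_union, not_or] at hcon
      exact hx (by simp [hθ, image_eq_zero_of_notMem_tsupport hcon.1,
        image_eq_zero_of_notMem_tsupport hcon.2])
    have h1 := h θ (hη.sub (contDiff_const.mul ψ.contDiff_normed))
      ((hηc.isCompact.union ψ.hasCompactSupport_normed.isCompact).of_isClosed_subset
        (isClosed_tsupport _) hsub)
      (hsub.trans (union_subset hηs hψs)) (by
        simp only [hθ]
        rw [integral_sub hηi' (hψi'.const_mul m), integral_const_mul, ψ.integral_normed]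
        simp [hm])
    have e1 : ∫ x, θ x * g x = (∫ x, η x * g x) - m * c := by
      rw [hc, ← integral_const_mul, ← integral_sub hηi (hψi.const_mul m)]
      congr 1; ext x; simp only [hθ]; ring
    have e2 : ∫ x, η x • (g x - c) = (∫ x, η x * g x) - m * c := by
      rw [hm, ← integral_mul_const, ← integral_sub hηi (hηi'.mul_const c)]
      congr 1; ext x; simp only [smul_eq_mul]; ring
    rw [e2, ← e1, h1]

theorem hasDerivAt_neg_integral {F : ℝ → ℝ} {R r : ℝ} (hF : ContinuousOn F (Ioo 0 R))
    (hr : r ∈ Ioo 0 R) (hi : IntervalIntegrable F volume r R) :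
    HasDerivAt (fun r => -∫ s in r..R, F s) (F r) r := by
  have h := (intervalIntegral.integral_hasDerivAt_left hi
    (hF.stronglyMeasurableAtFilter isOpen_Ioo r hr) (hF.continuousAt (Ioo_mem_nhds hr.1 hr.2))).neg
  rwa [neg_neg] at h

theorem intervalIntegrable_of_continuousOn_Ioc {F : ℝ → ℝ} {R r : ℝ}
    (hF : ContinuousOn F (Ioc 0 R)) (hr : r ∈ Ioc 0 R) : IntervalIntegrable F volume r R := by
  refine (hF.mono ?_).intervalIntegrable
  rw [uIcc_of_le hr.2]
  exact fun x hx => ⟨hr.1.trans_le hx.1, hx.2⟩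

/-- The primitive of a continuous function with compact support in `(0, R)` and mean zero. -/
def primitiveTest {R : ℝ} {θ : ℝ → ℝ} (hθ : Continuous θ) (h0 : ∫ x in (0 : ℝ)..R, θ x = 0) :
    testSpace R :=
  ⟨fun x => ∫ s in (0 : ℝ)..x, θ s, by
    refine ContDiff.contDiffOn (contDiff_one_iff_deriv.2 ⟨fun x =>
      (hθ.integral_hasStrictDerivAt 0 x).hasDerivAt.differentiableAt, ?_⟩)
    rw [funext fun x => (hθ.integral_hasStrictDerivAt 0 x).hasDerivAt.deriv]
    exact hθ, by simp, h0⟩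

theorem hasDerivAt_primitiveTest {R : ℝ} {θ : ℝ → ℝ} (hθ : Continuous θ)
    (h0 : ∫ x in (0 : ℝ)..R, θ x = 0) (r : ℝ) :
    HasDerivAt (primitiveTest hθ h0 : ℝ → ℝ) (θ r) r :=
  (hθ.integral_hasStrictDerivAt 0 r).hasDerivAt

/-- Integration by parts. F may be singular at 0, but θ vanishes near 0 and so does its primitive;
the boundary terms vanish because φ = 0 at δ and the integral from R to R is zero. -/
theorem integral_mul_primitiveTest {R : ℝ} (hR : 0 < R) {F θ : ℝ → ℝ}
    (hF : ContinuousOn F (Ioc 0 R)) (hθ : Continuous θ) (hs : tsupport θ ⊆ Ioo 0 R)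
    (h0 : ∫ x in (0 : ℝ)..R, θ x = 0) :
    ∫ r in Ioo 0 R, F r * (primitiveTest hθ h0 : ℝ → ℝ) r
      = -∫ r in Ioo 0 R, (-∫ s in r..R, F s) * θ r := by
  set φ : ℝ → ℝ := (primitiveTest hθ h0 : ℝ → ℝ) with hφ
  have hd : ∀ r, HasDerivAt φ (θ r) r := hasDerivAt_primitiveTest hθ h0
  obtain ⟨δ, hδ, hδθ⟩ : ∃ δ ∈ Ioo 0 R, ∀ x ≤ δ, θ x = 0 := by
    have hmem : (tsupport θ)ᶜ ∈ 𝓝 (0 : ℝ) :=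
      (isClosed_tsupport θ).isOpen_compl.mem_nhds fun h => lt_irrefl _ (hs h).1
    obtain ⟨ε, hε, hball⟩ := Metric.mem_nhds_iff.1 hmem
    refine ⟨min (ε / 2) (R / 2), ⟨by positivity, (min_le_right _ _).trans_lt (by linarith)⟩,
      fun x hx => image_eq_zero_of_notMem_tsupport fun h => ?_⟩
    have hx0 := (hs h).1
    refine hball ?_ h
    rw [mem_ball_zero_iff, Real.norm_eq_abs, abs_of_pos hx0]
    linarith [hx.trans (min_le_left _ _)]
  have hφ0 : ∀ x ∈ Icc 0 δ, φ x = 0 := fun x hx => by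
    change ∫ s in (0 : ℝ)..x, θ s = 0
    rw [intervalIntegral.integral_congr (g := fun _ => 0)]
    · simp
    · intro s hs'
      rw [uIcc_of_le hx.1] at hs'
      exact hδθ s (hs'.2.trans hx.2)
  have hsub : ∀ G : ℝ → ℝ, (∀ x ∈ Ioc 0 δ, G x = 0) →
      ∫ r in Ioo 0 R, G r = ∫ r in δ..R, G r := fun G hG => by
    rw [intervalIntegral.integral_of_le hδ.2.le, ← integral_Ioc_eq_integral_Ioo]
    refine setIntegral_eq_of_subset_of_forall_sdiff_eq_zero measurableSet_Ioc
      (Ioc_subset_Ioc_left hδ.1.le) fun x hx => hG x ⟨hx.1.1, ?_⟩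
    by_contra! hx'
    exact hx.2 ⟨hx', hx.1.2⟩
  rw [hsub _ fun x hx => by rw [hφ0 x ⟨hx.1.le, hx.2⟩, mul_zero],
    hsub _ fun x hx => by rw [hδθ x hx.2, mul_zero]]
  have hFi := intervalIntegrable_of_continuousOn_Ioc hF ⟨hδ.1, hδ.2.le⟩
  have hibp := intervalIntegral.integral_mul_deriv_eq_deriv_mul_of_hasDerivAt (a := δ) (b := R)
    (u := fun r => -∫ s in r..R, F s) (u' := F) (v := φ) (v' := θ) ?_
    (fun x _ => (hd x).continuousAt.continuousWithinAt) (fun x hx => ?_) (fun x _ => hd x) hFi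
    (hθ.intervalIntegrable _ _)
  · rw [hibp, hφ0 δ ⟨hδ.1.le, le_rfl⟩]
    simp
  · refine (intervalIntegral.continuousOn_primitive_interval_left ?_).neg
    rwa [← intervalIntegrable_iff']
  · rw [min_eq_left hδ.2.le, max_eq_right hδ.2.le] at hx
    have hx' : x ∈ Ioo 0 R := ⟨hδ.1.trans hx.1, hx.2⟩
    exact hasDerivAt_neg_integral (hF.mono Ioo_subset_Ioc_self) hx'
      (intervalIntegrable_of_continuousOn_Ioc hF ⟨hx'.1, hx'.2.le⟩)

theorem locallyIntegrableOn_hDer {R : ℝ} (U : HSpace R) :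
    LocallyIntegrableOn (hDer U) (Ioo 0 R) := by
  intro x hx
  have h := intervalIntegrable_hDer U (half_pos hx.1) ((half_lt_self hx.1).trans hx.2).le
  refine ⟨Ioo (x / 2) R, mem_nhdsWithin_of_mem_nhds
    (Ioo_mem_nhds (half_lt_self hx.1) hx.2), ?_⟩
  exact (intervalIntegrable_iff_integrableOn_Ioo_of_le ((half_lt_self hx.1).trans hx.2).le).1 h

/-- Weak solutions of `(r u')' = F(r, u)` on `(0, R)` are classical. -/
theorem exists_flux {n : ℤ} {R : ℝ} (hR : 0 < R) {w : ℝ → ℝ} (hw : Continuous w) (U : HSpace R)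
    (hU : ∀ Φ : HSpace R,
      qf n U Φ + ∫ r in Ioo 0 R, r * (w (rep U r) * rep U r * rep Φ r) = 0) :
    ∃ p : ℝ → ℝ, (∀ r ∈ Ioo 0 R, HasDerivAt (rep U) (p r / r) r) ∧
      (∀ r ∈ Ioo 0 R, HasDerivAt p (((n : ℝ) ^ 2 / r + r * w (rep U r)) * rep U r) r) ∧
      hDer U =ᵐ[volume.restrict (Ioo 0 R)] fun r => p r / r := by
  set F : ℝ → ℝ := fun r => ((n : ℝ) ^ 2 / r + r * w (rep U r)) * rep U r with hFdef
  have hF : ContinuousOn F (Ioc 0 R) := by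
    have hu := continuousOn_rep_Ioc U
    refine ((continuousOn_const.div continuousOn_id fun r hr => hr.1.ne').add
      (continuousOn_id.mul (hw.comp_continuousOn hu))).mul hu
  set W : ℝ → ℝ := fun r => -∫ s in r..R, F s with hWdef
  have hW : ∀ r ∈ Ioo 0 R, HasDerivAt W (F r) r := fun r hr =>
    hasDerivAt_neg_integral (hF.mono Ioo_subset_Ioc_self) hr
      (intervalIntegrable_of_continuousOn_Ioc hF ⟨hr.1, hr.2.le⟩)
  have hWc : ContinuousOn W (Ioo 0 R) := fun r hr => (hW r hr).continuousAt.continuousWithinAt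
  have hWl : LocallyIntegrableOn W (Ioo 0 R) := hWc.locallyIntegrableOn measurableSet_Ioo
  have hDl : LocallyIntegrableOn (fun r => r * hDer U r) (Ioo 0 R) :=
    (locallyIntegrableOn_hDer U).continuousOn_mul continuousOn_id isOpen_Ioo.isLocallyClosed
  -- Testing with the primitive of a mean-zero θ turns the weak equation into ∫ θ (r u' - W) = 0,
  -- hence r u' = W + c almost everywhere, where W' = F.
  obtain ⟨c, hc⟩ := ae_eq_const_of_integral_mul_eq_zero hR (hDl.sub hWl)
    fun θ hθ hθc hθs hθ0 => by
    have hzero : ∀ G : ℝ → ℝ, ∫ x, θ x * G x = ∫ x in Ioo 0 R, θ x * G x := fun G =>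
      (setIntegral_eq_integral_of_forall_compl_eq_zero fun x hx => by
        rw [image_eq_zero_of_notMem_tsupport fun h => hx (hθs h), zero_mul]).symm
    have h0 : ∫ x in (0 : ℝ)..R, θ x = 0 := by
      have := hzero fun _ => 1
      simp only [mul_one] at this
      rw [intervalIntegral.integral_of_le hR.le, integral_Ioc_eq_integral_Ioo, ← this, hθ0]
    have h1 := hU (ofTest (primitiveTest hθ.continuous h0))
    have i1 := integrable_mul_of_tsupport_subset hDl hθ.continuous hθc hθs
    have i2 := integrable_mul_of_tsupport_subset hWl hθ.continuous hθc hθs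
    have i3 := (integrableOn_invRadial_mul (U : PairSpace R).snd
      (ofTest (primitiveTest hθ.continuous h0) : PairSpace R).snd).const_mul ((n : ℝ) ^ 2)
    have i4 := integrableOn_radial_comp₂ (F := fun p => w p.1 * p.1 * p.2) (by fun_prop) U
      (ofTest (primitiveTest hθ.continuous h0))
    have e1 : ∫ r in Ioo 0 R, r * ((U : PairSpace R).fst r *
        (ofTest (primitiveTest hθ.continuous h0) : PairSpace R).fst r)
        = ∫ x, θ x * (x * hDer U x) := by
      rw [hzero]
      refine integral_congr_ae ?_
      filter_upwards [hDer_ofTest (primitiveTest hθ.continuous h0)] with r hr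
      rw [(hasDerivAt_primitiveTest hθ.continuous h0 r).deriv] at hr
      change r * (hDer U r * hDer (ofTest (primitiveTest hθ.continuous h0)) r) = _
      rw [hr]; ring
    have e2 : ∫ r in Ioo 0 R, ((n : ℝ) ^ 2 * (r⁻¹ * ((U : PairSpace R).snd r *
        (ofTest (primitiveTest hθ.continuous h0) : PairSpace R).snd r))
        + r * (w (rep U r) * rep U r * rep (ofTest (primitiveTest hθ.continuous h0)) r))
        = -∫ x, θ x * W x := by
      rw [hzero]
      have := integral_mul_primitiveTest hR hF hθ.continuous hθs h0
      simp only [mul_comm (θ _)]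
      rw [← this]
      refine integral_congr_ae ?_
      filter_upwards [hVal_ae_eq_rep U, hVal_ofTest (primitiveTest hθ.continuous h0),
        ae_restrict_mem measurableSet_Ioo] with r hr1 hr2 hr
      change (n : ℝ) ^ 2 * (r⁻¹ * (hVal U r *
        hVal (ofTest (primitiveTest hθ.continuous h0)) r)) + _ = _
      rw [hr1, hr2, rep_ofTest hr, hFdef]; ring
    rw [qf, inner_radial, inner_invRadial, ← integral_const_mul, add_assoc,
      ← integral_add i3 i4, e1, e2, ← sub_eq_add_neg, ← integral_sub i1 i2] at h1
    rw [← h1]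
    congr 1; ext x; simp only [Pi.sub_apply]; ring
  have hcD : hDer U =ᵐ[volume.restrict (Ioo 0 R)] fun r => (W r + c) / r := by
    filter_upwards [ae_restrict_of_ae hc, ae_restrict_mem measurableSet_Ioo] with r h hr
    have := h hr
    simp only [Pi.sub_apply] at this
    rw [eq_div_iff hr.1.ne']
    linarith
  refine ⟨fun r => W r + c, fun r hr => ?_, fun r hr => (hW r hr).add_const c, hcD⟩
  have hcont : ContinuousOn (fun r => (W r + c) / r) (Ioo 0 R) :=
    (hWc.add continuousOn_const).div continuousOn_id fun r hr => hr.1.ne'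
  have hcongr : ∀ s ∈ Ioo 0 R, hDer U =ᵐ[volume.restrict (uIoc s R)] fun r => (W r + c) / r := by
    intro s hs
    rw [uIoc_of_le hs.2.le, ← restrict_Ioo_eq_restrict_Ioc]
    exact ae_restrict_of_ae_restrict_of_subset (Ioo_subset_Ioo_left hs.1.le) hcD
  have hi : IntervalIntegrable (fun r => (W r + c) / r) volume r R :=
    (intervalIntegrable_hDer U hr.1 hr.2.le).congr_ae (hcongr r hr)
  refine (hasDerivAt_neg_integral hcont hr hi).congr_of_eventuallyEq ?_
  filter_upwards [Ioo_mem_nhds hr.1 hr.2] with s hs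
  rw [rep, intervalIntegral.integral_congr_ae_restrict (hcongr s hs)]

/-! ### Positivity and smoothness -/

/-- Nonnegative solutions that touch zero vanish identically. -/
theorem eq_zero_of_touch {R : ℝ} {u p q : ℝ → ℝ} (hq : ContinuousOn q (Ioc 0 R))
    (hu : ∀ r ∈ Ioo 0 R, HasDerivAt u (p r / r) r)
    (hp : ∀ r ∈ Ioo 0 R, HasDerivAt p (q r * u r) r) (hnonneg : ∀ r ∈ Ioo 0 R, 0 ≤ u r)
    {r₁ : ℝ} (hr₁ : r₁ ∈ Ioo 0 R) (h0 : u r₁ = 0) : ∀ r ∈ Ioo 0 R, u r = 0 := by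
  have hmin : IsLocalMin u r₁ := by
    filter_upwards [Ioo_mem_nhds hr₁.1 hr₁.2] with s hs
    rw [h0]; exact hnonneg s hs
  have hp0 : p r₁ = 0 := by
    have := hmin.hasDerivAt_eq_zero (hu r₁ hr₁)
    exact (div_eq_zero_iff.1 this).resolve_right hr₁.1.ne'
  intro r hr
  -- The system u' = p/t, p' = qu is singular at 0; on (a, R), which contains both points, its
  -- coefficients are bounded and uniqueness applies with zero data at r₁.
  set a := min r r₁ / 2 with ha
  have ha0 : 0 < a := half_pos (lt_min hr.1 hr₁.1)
  have har : a < min r r₁ := half_lt_self (lt_min hr.1 hr₁.1)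
  obtain ⟨C, hC⟩ := (isCompact_Icc (a := a) (b := R)).exists_bound_of_continuousOn
    (hq.mono fun x hx => ⟨ha0.trans_le hx.1, hx.2⟩)
  have hsub : Ioo a R ⊆ Ioo 0 R := Ioo_subset_Ioo_left ha0.le
  have key := ODE_solution_unique_of_mem_Ioo (a := a) (b := R) (t₀ := r₁)
    (v := fun t x => ((x.2 / t, q t * x.1) : ℝ × ℝ)) (s := fun _ => univ)
    (K := ⟨max a⁻¹ |C|, by positivity⟩) (f := fun t => (u t, p t)) (g := fun _ => (0, 0))
    (fun t ht => ?_) ⟨har.trans_le (min_le_right _ _), hr₁.2⟩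
    (fun t ht => ⟨(hu t (hsub ht)).prodMk (hp t (hsub ht)), mem_univ _⟩)
    (fun t ht => ⟨(hasDerivAt_const t ((0, 0) : ℝ × ℝ)).congr_deriv (by simp; rfl), mem_univ _⟩)
    (by simp [h0, hp0])
  · exact congrArg Prod.fst (key ⟨har.trans_le (min_le_left _ _), hr.2⟩)
  · refine LipschitzOnWith.of_dist_le_mul fun x _ y _ => ?_
    have ht0 : 0 < t := ha0.trans ht.1
    rw [dist_eq_norm, dist_eq_norm]
    change ‖((x.2 / t - y.2 / t, q t * x.1 - q t * y.1) : ℝ × ℝ)‖ ≤ max a⁻¹ |C| * ‖x - y‖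
    refine norm_prod_le_iff.2 ⟨?_, ?_⟩
    · change ‖x.2 / t - y.2 / t‖ ≤ _
      rw [← sub_div, div_eq_inv_mul, norm_mul, Real.norm_eq_abs, abs_of_pos (by positivity)]
      gcongr
      · exact (inv_anti₀ ha0 ht.1.le).trans (le_max_left _ _)
      · exact norm_snd_le (x - y)
    · change ‖q t * x.1 - q t * y.1‖ ≤ _
      rw [← mul_sub, norm_mul]
      gcongr
      · exact (hC t ⟨ht.1.le, ht.2.le⟩).trans ((le_abs_self C).trans (le_max_right _ _))
      · exact norm_fst_le (x - y)

theorem contDiffOn_succ_of_hasDerivAt {s : Set ℝ} (hs : IsOpen s) {f f' : ℝ → ℝ} (k : ℕ)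
    (h : ∀ x ∈ s, HasDerivAt f (f' x) x) (hf' : ContDiffOn ℝ k f' s) :
    ContDiffOn ℝ (k + 1) f s :=
  (contDiffOn_succ_iff_deriv_of_isOpen hs).2
    ⟨fun x hx => (h x hx).differentiableAt.differentiableWithinAt, by simp,
      hf'.congr fun x hx => (h x hx).deriv⟩

end Vortex

end

/-! ### The main theorem -/

open Vortex Filter Topology in
theorem theorem4p7 (n : ℤ) (hn : 1 ≤ |n|) (α R κ r₀ : ℝ) (hα : 0 < α) (hR : 0 < R)
    (hr₀ : IsLeast {x : ℝ | 0 < x ∧ Vortex.besselJ0 x = 0} r₀)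
    (hκ : κ ∈ Set.Ioo (-(((n : ℝ) ^ 2 + r₀ ^ 2) / (2 * R ^ 2)))
      (α⁻¹ - ((n : ℝ) ^ 2 + r₀ ^ 2) / (2 * R ^ 2)))
    (hRκ : Real.sqrt (6 * (1 + (n : ℝ) ^ 2 * (2 * Real.log 2 - 1)) / (α⁻¹ - κ)) < R) :
    ∃ (U : Vortex.HSpace R) (u : ℝ → ℝ),
      Vortex.hVal U =ᵐ[MeasureTheory.volume.restrict (Set.Ioo 0 R)] u ∧
      Vortex.hDer U =ᵐ[MeasureTheory.volume.restrict (Set.Ioo 0 R)] deriv u ∧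
      Vortex.IsVortexSolution n α κ R u ∧
      (∀ r ∈ Set.Ioo 0 R, 0 < u r) ∧
      U ∈ Vortex.nehari n α κ R ∧
      IsMinOn (Vortex.action n α κ R) (Vortex.nehari n α κ R) U := by
  have hquot : 2 * (((n : ℝ) ^ 2 + r₀ ^ 2) / (2 * R ^ 2)) = ((n : ℝ) ^ 2 + r₀ ^ 2) / R ^ 2 := by
    field_simp
  have hβ : 0 < α⁻¹ - κ := by
    have h1 : 0 < ((n : ℝ) ^ 2 + r₀ ^ 2) / (2 * R ^ 2) := by
      have := hr₀.1.1; positivity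
    linarith [hκ.2]
  have hlam : 0 < ((n : ℝ) ^ 2 + r₀ ^ 2) / R ^ 2 + 2 * κ := by linarith [hκ.1]
  have hP := poincare n hR hr₀
  obtain ⟨U, hU, hmin, hnonneg⟩ :=
    exists_nonneg_minimiser hn hα hR hβ hlam hP (exists_qf_lt hn hR hβ hRκ)
  have hpos := (rint_sq_pos_of_nehari hn hα hR hβ hU).2
  have hlt := qf_lt_of_nehariFunctional_nonpos hα hR hU.2.le hpos
  have hw := continuous_weight (κ := κ) hα
  obtain ⟨p, hu, hp, hD⟩ := exists_flux hR hw U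
    (euler_lagrange hα hR hβ hlam hP hU hlt hmin)
  -- The derivative is not known to be integrable up to 0, so `rep U 0` is uncontrolled; the cutoff
  -- imposes the boundary value 0, which is the limit of `rep U` there.
  set u : ℝ → ℝ := (Ioi 0).indicator (rep U) with hudef
  have huU : ∀ r, 0 < r → u r = rep U r := fun r hr => indicator_of_mem hr _
  have hu' : ∀ r ∈ Ioo 0 R, HasDerivAt u (p r / r) r := fun r hr =>
    (hu r hr).congr_of_eventuallyEq (by
      filter_upwards [Ioi_mem_nhds hr.1] with s hs using huU s hs)
  have hq : ContinuousOn (fun r => (n : ℝ) ^ 2 / r + r * weight α κ (rep U r)) (Ioc 0 R) :=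
    (continuousOn_const.div continuousOn_id fun r hr => hr.1.ne').add
      (continuousOn_id.mul (hw.comp_continuousOn (continuousOn_rep_Ioc U)))
  have hpc : ContDiffOn ℝ (0 + 1) p (Ioo 0 R) :=
    contDiffOn_succ_of_hasDerivAt isOpen_Ioo 0 hp
      (contDiffOn_zero.2 ((hq.mul (continuousOn_rep_Ioc U)).mono Ioo_subset_Ioc_self))
  refine ⟨U, u, ?_, ?_, ⟨?_, ?_, ?_, ?_, ?_⟩, ?_, hU, hmin⟩
  · filter_upwards [hVal_ae_eq_rep U, ae_restrict_mem measurableSet_Ioo] with r h1 hr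
    rw [h1, huU r hr.1]
  · filter_upwards [hD, ae_restrict_mem measurableSet_Ioo] with r h1 hr
    rw [h1, (hu' r hr).deriv]
  · intro r hr
    rcases hr.1.eq_or_lt with rfl | hr0
    · have h1 : Tendsto u (𝓝[>] 0) (𝓝 (u 0)) := by
        have h0 : u 0 = 0 := indicator_of_notMem (lt_irrefl _) _
        rw [h0]
        refine (tendsto_rep_zero hR U).congr' ?_
        filter_upwards [self_mem_nhdsWithin] with s hs using (huU s hs).symm
      exact (continuousWithinAt_Ioi_iff_Ici.1 h1).mono Icc_subset_Ici_self
    · have h1 := (continuousOn_rep_Ioc U r ⟨hr0, hr.2⟩).congr_of_eventuallyEq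
        (g := u) (by filter_upwards [self_mem_nhdsWithin] with s hs using huU s hs.1)
        (huU r hr0)
      refine h1.mono_of_mem_nhdsWithin ?_
      filter_upwards [self_mem_nhdsWithin, mem_nhdsWithin_of_mem_nhds (Ioi_mem_nhds hr0)]
        with s hs hs0 using ⟨hs0, hs.2⟩
  · have hpd : ContDiffOn ℝ (1 : ℕ) (fun r => p r / r) (Ioo 0 R) := by
      rw [zero_add] at hpc
      exact hpc.div contDiffOn_id fun r hr => hr.1.ne'
    have := contDiffOn_succ_of_hasDerivAt isOpen_Ioo 1 hu' hpd
    norm_num at this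
    exact this
  · intro r hr
    have h1 : (fun s => s * deriv u s) =ᶠ[𝓝 r] p := by
      filter_upwards [Ioo_mem_nhds hr.1 hr.2] with s hs
      rw [(hu' s hs).deriv, mul_div_cancel₀ _ hs.1.ne']
    -- Since `weight α κ x` equals 2κ - 2x²/(1 + αx²), the equation for the flux p is the vortex
    -- equation.
    rw [h1.deriv_eq, (hp r hr).deriv, huU r hr.1, weight]
    have h2 : 0 < 1 + α * rep U r ^ 2 := by positivity
    have h3 := hr.1
    field_simp
    ring
  · simp [hudef]
  · rw [huU R hR, rep_right]
  · intro r hr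
    rw [huU r hr.1]
    -- An interior zero would force u = 0 on all of (0, R), contradicting ∫ r u² > 0.
    refine (hnonneg r hr).lt_of_ne fun h => hpos.ne' ?_
    have hz := eq_zero_of_touch hq hu hp hnonneg hr h.symm
    rw [rint, setIntegral_congr_fun (g := fun _ => 0) measurableSet_Ioo fun s hs => by simp [hz s hs]]
    simp
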